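/- Let $N,T\ge 1$ be integers and let $\mathbf H$ be a random vector in $\mathbb C^{N}$ whose distribution (not necessarily Gaussian) satisfies $h(\mathbf H)>-\infty$ and $\mathbb E\|\mathbf H\|^2<\infty$, where $h$ denotes differential entropy (with $h=-\infty$ if $\mathbf H$ has no density). Consider the non-coherent single-user SIMO block-fading channel with coherence time $T$, $$\mathbf Y=\mathbf H\,\mathbf X^{\mathsf T}+\mathbf Z\in\mathbb C^{N\times T},$$ where $\mathbf Z$ has i.i.d. $\mathcal{CN}(0,1)$ entries, the input $\mathbf X\in\mathbb C^{T}$, $\mathbf H$ and $\mathbf Z$ are independent, and neither the transmitter nor the receiver knows the realization of $\mathbf H$. Logarithms are in base $2$ and $\log^+x=\max\{\log x,0\}$. Then: (i) There are constants $c>0$ and $P_0$, depending only on $N$, $T$ and the distribution of $\mathbf H$, such that for every $P\ge P_0$ and every input distribution satisfying the average power constraint $\mathbb E\|\mathbf X\|^2\le PT$ (in particular, every one satisfying the peak power constraint $\|\mathbf X\|^2\le P$ almost surely), $$I(\mathbf X;\mathbf Y)\le (T-1)\log^+P+c\,\log\log P .$$ (ii) Let $C(P)=\sup\frac1T I(\mathbf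 X;\mathbf Y)$ be the capacity in bits per channel use at SNR $P$, the supremum being over all input distributions with $\mathbb E\|\mathbf X\|^2\le PT$. Every achievable number of degrees of freedom $d=\liminf_{P\to\infty}\frac{R(P)}{\log P}$, where $R(P)\le C(P)$ for all $P>0$, satisfies $$d\le 1-\frac1T .$$ -/

import Mathlib

open MeasureTheory ProbabilityTheory Filter
open scoped ENNReal

noncomputable section

namespace SIMO

/-- Differential entropy, in bits, of a law `μ` on a space with a reference (Lebesgue) volume:
`h(μ) = E[-log₂ p]`, where `p` is the density of `μ`, computed as the expectation of the positive
part minus the expectation of the negative part. It is `-∞` if `μ` has no density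
(and, in `EReal`, `∞ - ∞ = -∞`). -/
def diffEntropy {E : Type*} [MeasureSpace E] (μ : Measure E) : EReal :=
  open scoped Classical in
  if μ ≪ volume then
    ((∫⁻ y, ENNReal.ofReal (-Real.logb 2 (μ.rnDeriv volume y).toReal) ∂μ : ℝ≥0∞) : EReal)
      - ((∫⁻ y, ENNReal.ofReal (Real.logb 2 (μ.rnDeriv volume y).toReal) ∂μ : ℝ≥0∞) : EReal)
  else ⊥

/-- Mutual information `I(U;V)`, in bits: the Kullback-Leibler divergence (which Mathlib measures
in nats) between the joint law and the product of the marginal laws. -/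
def mutualInfo {Ω A B : Type*} [MeasurableSpace Ω] [MeasurableSpace A] [MeasurableSpace B]
    (U : Ω → A) (V : Ω → B) (μ : Measure Ω) : ℝ≥0∞ :=
  InformationTheory.klDiv (μ.map fun ω => (U ω, V ω)) ((μ.map U).prod (μ.map V))
    / ENNReal.ofReal (Real.log 2)

/-- The squared Euclidean norm on `ℂⁿ`. -/
def normSq {n : ℕ} (v : Fin n → ℂ) : ℝ := ∑ i, ‖v i‖ ^ 2

/-- The standard circularly symmetric complex Gaussian law `CN(0,1)`: independent real and
imaginary parts, each centred Gaussian with variance `1/2`. -/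
def stdComplexGaussian : Measure ℂ :=
  ((gaussianReal 0 (1 / 2)).prod (gaussianReal 0 (1 / 2))).map
    fun p : ℝ × ℝ => (⟨p.1, p.2⟩ : ℂ)

/-- Law of the noise: an `N × T` matrix with i.i.d. `CN(0,1)` entries. -/
def noiseLaw (N T : ℕ) : Measure (Fin N → Fin T → ℂ) :=
  Measure.pi fun _ => Measure.pi fun _ => stdComplexGaussian

/-- Law of `(X, H, Z)`: input, fading vector and noise are independent. -/
def sourceLaw {N T : ℕ} (μX : Measure (Fin T → ℂ)) (μH : Measure (Fin N → ℂ)) :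
    Measure ((Fin T → ℂ) × (Fin N → ℂ) × (Fin N → Fin T → ℂ)) :=
  μX.prod (μH.prod (noiseLaw N T))

/-- The input `X` of one coherence block. -/
def input {N T : ℕ} (ω : (Fin T → ℂ) × (Fin N → ℂ) × (Fin N → Fin T → ℂ)) : Fin T → ℂ := ω.1

/-- The output `Y = H Xᵀ + Z` of one coherence block. -/
def output {N T : ℕ} (ω : (Fin T → ℂ) × (Fin N → ℂ) × (Fin N → Fin T → ℂ)) :
    Fin N → Fin T → ℂ :=
  fun i t => ω.2.1 i * ω.1 t + ω.2.2 i t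

/-- `I(X;Y)` in bits per coherence block, for the input law `μX` and the fading law `μH`. -/
def blockInfo {N T : ℕ} (μX : Measure (Fin T → ℂ)) (μH : Measure (Fin N → ℂ)) : ℝ≥0∞ :=
  mutualInfo input output (sourceLaw μX μH)

/-- The average power constraint `E‖X‖² ≤ P T` on an input law. -/
def AveragePower {T : ℕ} (P : ℝ) (μX : Measure (Fin T → ℂ)) : Prop :=
  ∫⁻ x, ENNReal.ofReal (normSq x) ∂μX ≤ ENNReal.ofReal (P * T)

/-- The capacity at SNR `P` in bits per channel use: the supremum of `I(X;Y) / T` over the input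
distributions that satisfy the average power constraint. -/
def capacity {N : ℕ} (T : ℕ) (μH : Measure (Fin N → ℂ)) (P : ℝ) : ℝ≥0∞ :=
  ⨆ (μX : Measure (Fin T → ℂ)) (_ : IsProbabilityMeasure μX) (_ : AveragePower P μX),
    blockInfo μX μH / (T : ℝ≥0∞)

/-- `d` is an achievable number of degrees of freedom: `d = liminf R(P) / log₂ P` as `P → ∞`, for
a rate function `R` that does not exceed the capacity at any SNR. -/
def IsAchievableDoF {N : ℕ} (T : ℕ) (μH : Measure (Fin N → ℂ)) (d : EReal) : Prop :=
  ∃ R : ℝ → ℝ, (∀ P : ℝ, 0 < P → (R P : EReal) ≤ (capacity T μH P : EReal)) ∧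
    d = liminf (fun P : ℝ => ((R P / Real.logb 2 P : ℝ) : EReal)) atTop

end SIMO

end

namespace SIMO

/-! By duality, I(X;Y) is at most the mean divergence of the channel law given X = x from any fixed
output law Q. By data processing this divergence may be bounded on the pair (H,Y), provided Q is the
Y-marginal of a density q(h,y|x) whose Y-marginal is the same for every x.

In the q used here the T entries of the first output row are heavy-tailed with parameter δ. Up to
integrable terms, each costs (1+δ) log(1+‖x‖²) + log(1/δ). Every other row differs from h_i/h_0
times the first row by noise only, so it costs nothing that grows with x. Finally, x and the first
row determine h_0 up to an error of order (1+‖x‖²)^{-1/2}. A density concentrated at that scale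
earns back log(1+‖x‖²), and this turns T into T-1.

The true density of (H,Y) given x is at most that of H, because the noise density is at most 1. What
remains are the means of log⁺ of the density of H, of log(1+|·|²) of fading and noise entries, and
of log⁻|h_0|, all finite by the entropy and moment hypotheses. Jensen replaces ‖x‖² by PT. The
choice δ = 1/log P keeps δ log P bounded and makes log(1/δ) = log log P. Dividing by T log P gives
(ii).

The argument rests on `klDiv_map_prod_le`, `integrable_negLog_norm`, `lintegral_latentDensity`,
`lintegral_channel_le` and `ofReal_exp_neg_channelCost_le`. -/

/-! ### Duality bound for mutual information. -/

/-- Integrability and integral bound for the real part of an `ℝ≥0∞`-valued function whose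
Lebesgue integral is at most one. -/
lemma integrable_toReal_of_lintegral_le_one {Ω : Type*} [MeasurableSpace Ω] {μ : Measure Ω}
    {f : Ω → ℝ≥0∞} (hf : AEMeasurable f μ) (h : ∫⁻ ω, f ω ∂μ ≤ 1) :
    Integrable (fun ω => (f ω).toReal) μ ∧ ∫ ω, (f ω).toReal ∂μ ≤ 1 := by
  have hne : ∫⁻ ω, f ω ∂μ ≠ ∞ := ne_top_of_le_ne_top ENNReal.one_ne_top h
  refine ⟨integrable_toReal_of_lintegral_ne_top hf hne, ?_⟩
  rw [integral_toReal hf (ae_lt_top' hf hne)]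
  exact ENNReal.toReal_mono ENNReal.one_ne_top h

/-- The inverse of a Radon-Nikodym derivative integrates to at most the mass of the reference. -/
lemma lintegral_inv_rnDeriv_le {B : Type*} [MeasurableSpace B] (μ ν : Measure B)
    [SigmaFinite μ] [SigmaFinite ν] (h : μ ≪ ν) :
    ∫⁻ y, (μ.rnDeriv ν y)⁻¹ ∂μ ≤ ν Set.univ := by
  have hd : ν.withDensity (μ.rnDeriv ν) = μ := Measure.withDensity_rnDeriv_eq _ _ h
  have hm := Measure.measurable_rnDeriv μ ν
  calc ∫⁻ y, (μ.rnDeriv ν y)⁻¹ ∂μ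
      = ∫⁻ y, (μ.rnDeriv ν y)⁻¹ ∂(ν.withDensity (μ.rnDeriv ν)) := by rw [hd]
    _ = ∫⁻ y, (μ.rnDeriv ν * fun y => (μ.rnDeriv ν y)⁻¹) y ∂ν :=
        lintegral_withDensity_eq_lintegral_mul _ hm hm.inv
    _ ≤ ∫⁻ _, 1 ∂ν := lintegral_mono fun y => ENNReal.mul_inv_le_one _
    _ = ν Set.univ := by simp

/-- Duality bound for mutual information. If tilting `μ` by `exp (-ℓ)` makes the joint law of
`(U, V)` at most the product of the law of `U` with a sub-probability `Q`, then
`I(U;V) ≤ E[ℓ]` (in nats). -/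
theorem klDiv_map_prod_le {Ω A B : Type*} [MeasurableSpace Ω] [MeasurableSpace A]
    [MeasurableSpace B] {μ : Measure Ω} [IsProbabilityMeasure μ] {U : Ω → A} {V : Ω → B}
    (hU : Measurable U) (hV : Measurable V) (Q : Measure B) (hQ : Q Set.univ ≤ 1) {ℓ : Ω → ℝ}
    (hℓm : Measurable ℓ) (hℓ : Integrable ℓ μ)
    (h : ∀ G : A × B → ℝ≥0∞, Measurable G →
      ∫⁻ ω, G (U ω, V ω) * ENNReal.ofReal (Real.exp (-ℓ ω)) ∂μ ≤ ∫⁻ p, G p ∂((μ.map U).prod Q)) :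
    InformationTheory.klDiv (μ.map fun ω => (U ω, V ω)) ((μ.map U).prod (μ.map V))
      ≤ ENNReal.ofReal (∫ ω, ℓ ω ∂μ) := by
  have : IsFiniteMeasure Q := ⟨hQ.trans_lt ENNReal.one_lt_top⟩
  have hUV : Measurable fun ω => (U ω, V ω) := hU.prodMk hV
  have : IsProbabilityMeasure (μ.map U) := Measure.isProbabilityMeasure_map hU.aemeasurable
  have : IsProbabilityMeasure (μ.map V) := Measure.isProbabilityMeasure_map hV.aemeasurable
  set J := μ.map fun ω => (U ω, V ω) with hJ
  have : IsProbabilityMeasure J := Measure.isProbabilityMeasure_map hUV.aemeasurable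
  set ν := (μ.map U).prod (μ.map V) with hν
  set g := (μ.map V).rnDeriv Q with hg
  set L := J.rnDeriv ν with hL
  have hgm : Measurable g := Measure.measurable_rnDeriv _ _
  have hLm : Measurable L := Measure.measurable_rnDeriv _ _
  have hgm₂ : Measurable fun p : A × B => g p.2 := hgm.comp measurable_snd
  -- The tilt exp(-ℓ) is strictly positive, so testing `h` on indicators of null sets suffices.
  have hJQ : J ≪ (μ.map U).prod Q := by
    refine Measure.AbsolutelyContinuous.mk fun S hS h0 => ?_
    have h1 := h (S.indicator 1) (measurable_one.indicator hS)
    have hm : Measurable fun ω =>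
        S.indicator (1 : A × B → ℝ≥0∞) (U ω, V ω) * ENNReal.ofReal (Real.exp (-ℓ ω)) :=
      ((measurable_one.indicator hS).comp hUV).mul (by fun_prop)
    rw [lintegral_indicator_one hS, h0, nonpos_iff_eq_zero, lintegral_eq_zero_iff hm] at h1
    rw [hJ, Measure.map_apply hUV hS, measure_eq_zero_iff_ae_notMem]
    filter_upwards [h1] with ω hω hmem
    have hmem' : (U ω, V ω) ∈ S := hmem
    simp only [Set.indicator_of_mem hmem', Pi.one_apply, one_mul, Pi.zero_apply,
      ENNReal.ofReal_eq_zero] at hω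
    exact (Real.exp_pos _).not_ge hω
  have hVQ : μ.map V ≪ Q := by
    have h1 : J.map Prod.snd = μ.map V := by
      rw [hJ, Measure.map_map measurable_snd hUV]; rfl
    have h2 : ((μ.map U).prod Q).map Prod.snd = Q := by
      simp
    rw [← h1, ← h2]
    exact hJQ.map measurable_snd
  have hVd : Q.withDensity g = μ.map V := Measure.withDensity_rnDeriv_eq _ _ hVQ
  have hνd : ν = ((μ.map U).prod Q).withDensity (fun p => g p.2) := by
    rw [hν, ← hVd, prod_withDensity_right hgm]
  have hgpos : ∀ᵐ ω ∂μ, 0 < g (V ω) := ae_of_ae_map hV.aemeasurable (Measure.rnDeriv_pos hVQ)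
  have hgtop : ∀ᵐ ω ∂μ, g (V ω) < ∞ :=
    ae_of_ae_map hV.aemeasurable (hVQ.ae_le (Measure.rnDeriv_lt_top _ _))
  have hJν : J ≪ ν := by
    refine Measure.AbsolutelyContinuous.mk fun S hS h0 => ?_
    rw [hνd, withDensity_apply_eq_zero hgm₂] at h0
    have h1 := hJQ h0
    have hm : MeasurableSet ({p : A × B | g p.2 ≠ 0} ∩ S) :=
      (measurableSet_eq_fun hgm₂ measurable_const).compl.inter hS
    rw [hJ, Measure.map_apply hUV hm, measure_eq_zero_iff_ae_notMem] at h1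
    rw [hJ, Measure.map_apply hUV hS, measure_eq_zero_iff_ae_notMem]
    filter_upwards [h1, hgpos] with ω h1 h2 h3
    exact h1 ⟨h2.ne', h3⟩
  have hJd : ν.withDensity L = J := Measure.withDensity_rnDeriv_eq _ _ hJν
  have hLpos : ∀ᵐ ω ∂μ, 0 < L (U ω, V ω) :=
    ae_of_ae_map hUV.aemeasurable (Measure.rnDeriv_pos hJν)
  have hLtop : ∀ᵐ ω ∂μ, L (U ω, V ω) < ∞ :=
    ae_of_ae_map hUV.aemeasurable (hJν.ae_le (Measure.rnDeriv_lt_top _ _))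
  have hνfin : ν Set.univ = 1 := by simp [hν]
  -- Taking G = L·g in `h` turns g·d(P_U × Q) into dν, and L integrates to 1 against ν.
  have hLg : ∫⁻ ω, L (U ω, V ω) * g (V ω) * ENNReal.ofReal (Real.exp (-ℓ ω)) ∂μ ≤ 1 := by
    refine (h (fun p => L p * g p.2) (hLm.mul hgm₂)).trans ?_
    calc ∫⁻ p, L p * g p.2 ∂((μ.map U).prod Q)
        = ∫⁻ p, ((fun p : A × B => g p.2) * L) p ∂((μ.map U).prod Q) := by
          simp only [Pi.mul_apply, mul_comm]
      _ = ∫⁻ p, L p ∂ν := by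
          rw [hνd, lintegral_withDensity_eq_lintegral_mul _ hgm₂ hLm]
      _ = J Set.univ := by rw [← hJd, withDensity_apply _ .univ, Measure.restrict_univ]
      _ ≤ 1 := prob_le_one
  have hginv : ∫⁻ ω, (g (V ω))⁻¹ ∂μ ≤ 1 := by
    rw [← lintegral_map (f := fun y => (g y)⁻¹) hgm.inv hV]
    exact (lintegral_inv_rnDeriv_le _ _ hVQ).trans hQ
  have hLinv : ∫⁻ ω, (L (U ω, V ω))⁻¹ ∂μ ≤ 1 := by
    rw [← lintegral_map (f := fun y => (L y)⁻¹) hLm.inv hUV]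
    exact (lintegral_inv_rnDeriv_le _ _ hJν).trans hνfin.le
  obtain ⟨ia, ha⟩ := integrable_toReal_of_lintegral_le_one
    (((hLm.comp hUV).mul (hgm.comp hV)).mul (by fun_prop)).aemeasurable hLg
  obtain ⟨ib, hb⟩ := integrable_toReal_of_lintegral_le_one (hgm.comp hV).inv.aemeasurable hginv
  obtain ⟨ic, -⟩ := integrable_toReal_of_lintegral_le_one (hLm.comp hUV).inv.aemeasurable hLinv
  simp only [Pi.mul_apply, Pi.inv_apply, Function.comp_apply] at ia ha ib hb ic
  have hllr : Measurable (llr J ν) := measurable_llr _ _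
  -- Sum of log t ≤ t - 1 at t = L g exp(-ℓ) and at t = 1/g. The log g terms cancel, and both t have
  -- mean at most 1, which offsets the -2.
  have hupper : ∀ᵐ ω ∂μ, llr J ν (U ω, V ω) ≤
      ℓ ω + (L (U ω, V ω) * g (V ω) * ENNReal.ofReal (Real.exp (-ℓ ω))).toReal
        + ((g (V ω))⁻¹).toReal - 2 := by
    filter_upwards [hgpos, hgtop, hLpos, hLtop] with ω h1 h2 h3 h4
    have hgr : 0 < (g (V ω)).toReal := ENNReal.toReal_pos h1.ne' h2.ne
    have hLr : 0 < (L (U ω, V ω)).toReal := ENNReal.toReal_pos h3.ne' h4.ne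
    have he := Real.exp_pos (-ℓ ω)
    rw [llr_def, ENNReal.toReal_mul, ENNReal.toReal_mul, ENNReal.toReal_ofReal he.le,
      ENNReal.toReal_inv]
    have e1 := Real.log_le_sub_one_of_pos (mul_pos (mul_pos hLr hgr) he)
    have e2 := Real.log_le_sub_one_of_pos (inv_pos.2 hgr)
    rw [Real.log_mul (mul_pos hLr hgr).ne' he.ne', Real.log_mul hLr.ne' hgr.ne',
      Real.log_exp] at e1
    rw [Real.log_inv] at e2
    linarith
  -- Needed only for integrability of the log-likelihood ratio, without which the divergence would
  -- be infinite.
  have hlower : ∀ᵐ ω ∂μ, 1 - ((L (U ω, V ω))⁻¹).toReal ≤ llr J ν (U ω, V ω) := by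
    filter_upwards [hLpos, hLtop] with ω h3 h4
    have hLr : 0 < (L (U ω, V ω)).toReal := ENNReal.toReal_pos h3.ne' h4.ne
    rw [llr_def, ENNReal.toReal_inv]
    exact Real.one_sub_inv_le_log_of_pos hLr
  have iup := ((hℓ.add ia).add ib).sub (integrable_const (2 : ℝ))
  have illr : Integrable (fun ω => llr J ν (U ω, V ω)) μ :=
    integrable_of_le_of_le (hllr.comp hUV).aestronglyMeasurable hlower hupper
      ((integrable_const _).sub ic) iup
  have illr' : Integrable (llr J ν) J :=
    (integrable_map_measure hllr.aestronglyMeasurable hUV.aemeasurable).2 illr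
  rw [InformationTheory.klDiv_of_ac_of_integrable hJν illr']
  refine ENNReal.ofReal_le_ofReal ?_
  have e : ∫ p, llr J ν p ∂J = ∫ ω, llr J ν (U ω, V ω) ∂μ :=
    integral_map hUV.aemeasurable hllr.aestronglyMeasurable
  have e2 : ∫ ω, llr J ν (U ω, V ω) ∂μ ≤ _ := integral_mono_ae illr iup hupper
  simp only [Pi.sub_apply, Pi.add_apply] at e2
  rw [integral_sub (by exact (hℓ.add ia).add ib) (integrable_const _),
    integral_add (by exact hℓ.add ia) ib, integral_add hℓ ia] at e2
  simp only [integral_const, probReal_univ, smul_eq_mul, one_mul] at e2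
  rw [e]
  simp only [probReal_univ, hν]
  simp only [← hν]
  linarith

/-! ### Product measures and changes of variables. -/

/-- The outer measure behind `Measure.pi ν` is the largest one bounded on boxes by the product of
the sides, so a comparison on boxes is enough. -/
lemma measure_pi_mono {ι : Type*} [Fintype ι] {α : ι → Type*} [∀ i, MeasurableSpace (α i)]
    {μ ν : ∀ i, Measure (α i)} [∀ i, SigmaFinite (μ i)] (h : ∀ i, μ i ≤ ν i) :
    Measure.pi μ ≤ Measure.pi ν := by
  have key : (Measure.pi μ).toOuterMeasure ≤
      OuterMeasure.pi fun i => (ν i).toOuterMeasure := by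
    rw [OuterMeasure.le_pi]
    intro s _
    change Measure.pi μ (Set.univ.pi s) ≤ _
    rw [Measure.pi_pi]
    exact Finset.prod_le_prod' fun i _ => h i (s i)
  refine Measure.le_iff.2 fun s hs => ?_
  have h2 : Measure.pi ν s = OuterMeasure.pi (fun i => (ν i).toOuterMeasure) s := by
    rw [Measure.pi, toMeasure_apply _ _ hs]
  rw [h2]
  exact key s

lemma lintegral_fin_succ {E : Type*} [MeasureSpace E] [SigmaFinite (volume : Measure E)] {n : ℕ}
    {F : (Fin (n + 1) → E) → ℝ≥0∞} (hF : Measurable F) :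
    ∫⁻ x, F x = ∫⁻ a : E, ∫⁻ v : Fin n → E, F (Fin.cons a v : Fin (n + 1) → E) := by
  have e := (volume_preserving_piFinSuccAbove (fun _ : Fin (n + 1) => E) 0).symm
  rw [← e.lintegral_comp hF]
  rw [Measure.volume_eq_prod, lintegral_prod _ (by fun_prop)]
  simp only [MeasurableEquiv.piFinSuccAbove_symm_apply, Fin.insertNthEquiv_zero]
  rfl

lemma lintegral_fin_prod {E : Type*} [MeasureSpace E] [SigmaFinite (volume : Measure E)] {n : ℕ}
    {f : Fin n → E → ℝ≥0∞} (hf : ∀ i, Measurable (f i)) :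
    ∫⁻ x : Fin n → E, ∏ i, f i (x i) = ∏ i, ∫⁻ a, f i a := by
  induction n with
  | zero => simp [volume_pi]
  | succ n ih =>
    have hm : Measurable fun x : Fin (n + 1) → E => ∏ i, f i (x i) :=
      Finset.measurable_prod _ fun i _ => (hf i).comp (measurable_pi_apply i)
    have hm' : Measurable fun v : Fin n → E => ∏ i, f i.succ (v i) :=
      Finset.measurable_prod _ fun i _ => (hf i.succ).comp (measurable_pi_apply i)
    rw [lintegral_fin_succ hm]
    simp only [Fin.prod_univ_succ, Fin.cons_zero, Fin.cons_succ]
    simp_rw [lintegral_const_mul _ hm', ih fun i => hf i.succ]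
    rw [lintegral_mul_const _ (hf 0)]

lemma lintegral_comp_mul_add (f : ℂ → ℝ≥0∞) {c : ℂ} (hc : c ≠ 0) (d : ℂ) :
    ∫⁻ a, f (c * a + d) = ENNReal.ofReal (‖c‖ ^ 2)⁻¹ * ∫⁻ a, f a := by
  have hdet : LinearMap.det (LinearMap.mul ℝ ℂ c) = ‖c‖ ^ 2 := by
    have := Algebra.norm_complex_apply c
    rw [Algebra.norm_apply] at this
    rw [Complex.normSq_eq_norm_sq] at this
    exact this
  have hpos : 0 < ‖c‖ ^ 2 := by positivity
  have hmap := Measure.map_linearMap_addHaar_eq_smul_addHaar (volume : Measure ℂ)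
    (f := LinearMap.mul ℝ ℂ c) (by rw [hdet]; exact hpos.ne')
  rw [hdet, abs_of_pos (inv_pos.2 hpos)] at hmap
  have hmul : ∀ f : ℂ → ℝ≥0∞, ∫⁻ a, f (c * a) = ENNReal.ofReal (‖c‖ ^ 2)⁻¹ * ∫⁻ a, f a := by
    intro f
    have he : MeasurableEmbedding (LinearMap.mul ℝ ℂ c) :=
      (Homeomorph.mulLeft₀ c hc).measurableEmbedding
    rw [← smul_eq_mul, ← lintegral_smul_measure, ← hmap, he.lintegral_map]
    rfl
  rw [hmul (fun a => f (a + d)), lintegral_add_right_eq_self]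

lemma lintegral_comp_norm {f : ℝ → ℝ≥0∞} (hf : Measurable f) :
    ∫⁻ a : ℂ, f ‖a‖ =
      ENNReal.ofReal (2 * Real.pi) * ∫⁻ r in Set.Ioi (0 : ℝ), ENNReal.ofReal r * f r := by
  rw [← Complex.lintegral_comp_polarCoord_symm, polarCoord_target]
  have h1 : ∫⁻ p in Set.Ioi (0 : ℝ) ×ˢ Set.Ioo (-Real.pi) Real.pi,
      ENNReal.ofReal p.1 • f ‖Complex.polarCoord.symm p‖ =
      ∫⁻ p in Set.Ioi (0 : ℝ) ×ˢ Set.Ioo (-Real.pi) Real.pi, ENNReal.ofReal p.1 * f p.1 := by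
    refine setLIntegral_congr_fun (measurableSet_Ioi.prod measurableSet_Ioo) fun p hp => ?_
    simp only [Complex.norm_polarCoord_symm, smul_eq_mul]
    rw [abs_of_pos hp.1]
  rw [h1, Measure.volume_eq_prod, ← Measure.prod_restrict, lintegral_prod _ (by fun_prop)]
  simp only [lintegral_const, Measure.restrict_apply_univ, Real.volume_Ioo]
  rw [lintegral_mul_const _ (by fun_prop), mul_comm]
  congr 2
  ring

/-! ### The heavy-tailed density on the plane. -/

/-- The heavy-tailed rotation-invariant density `(δ/π) (1 + |a|²)^{-(1+δ)}` on the plane. -/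
noncomputable def heavyTail (δ : ℝ) (a : ℂ) : ℝ≥0∞ :=
  ENNReal.ofReal (δ / Real.pi * (1 + ‖a‖ ^ 2) ^ (-(1 + δ)))

@[fun_prop]
lemma measurable_heavyTail (δ : ℝ) : Measurable (heavyTail δ) := by
  unfold heavyTail
  fun_prop

lemma lintegral_heavyTail {δ : ℝ} (hδ : 0 < δ) : ∫⁻ a, heavyTail δ a = 1 := by
  have hpi := Real.pi_pos
  unfold heavyTail
  rw [lintegral_comp_norm (f := fun r => ENNReal.ofReal (δ / Real.pi * (1 + r ^ 2) ^ (-(1 + δ))))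
    (by fun_prop)]
  -- In polar coordinates the integrand is an exact derivative, whose primitive rises from -1 at r =
  -- 0 to 0 at infinity.
  have hderiv : ∀ r ∈ Set.Ici (0 : ℝ), HasDerivAt (fun r : ℝ => -(1 + r ^ 2) ^ (-δ))
      (2 * δ * (r * (1 + r ^ 2) ^ (-(1 + δ)))) r := by
    intro r _
    have h1 : HasDerivAt (fun r : ℝ => 1 + r ^ 2) (2 * r) r := by
      simpa using (hasDerivAt_pow 2 r).const_add 1
    have h2 := (h1.rpow_const (p := -δ) (Or.inl (by positivity))).neg
    refine h2.congr_deriv ?_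
    rw [show -δ - 1 = -(1 + δ) by ring]
    ring
  have hnonneg : ∀ r ∈ Set.Ioi (0 : ℝ), 0 ≤ 2 * δ * (r * (1 + r ^ 2) ^ (-(1 + δ))) := by
    intro r hr
    have : (0 : ℝ) < r := hr
    positivity
  have hlim : Tendsto (fun r : ℝ => -(1 + r ^ 2) ^ (-δ)) atTop (nhds 0) := by
    have h1 : Tendsto (fun r : ℝ => 1 + r ^ 2) atTop atTop :=
      tendsto_atTop_add_const_left _ _ (tendsto_pow_atTop two_ne_zero)
    simpa using ((tendsto_rpow_neg_atTop hδ).comp h1).neg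
  have h_int := integrableOn_Ioi_deriv_of_nonneg' hderiv hnonneg hlim
  have hval := integral_Ioi_of_hasDerivAt_of_nonneg' hderiv hnonneg hlim
  rw [← lintegral_const_mul _ (by fun_prop)]
  have h2 : ∫⁻ r in Set.Ioi (0 : ℝ), ENNReal.ofReal (2 * Real.pi) *
      (ENNReal.ofReal r * ENNReal.ofReal (δ / Real.pi * (1 + r ^ 2) ^ (-(1 + δ)))) =
      ∫⁻ r in Set.Ioi (0 : ℝ), ENNReal.ofReal (2 * δ * (r * (1 + r ^ 2) ^ (-(1 + δ)))) := by
    refine setLIntegral_congr_fun measurableSet_Ioi fun r hr => ?_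
    have : (0 : ℝ) < r := hr
    rw [← ENNReal.ofReal_mul this.le, ← ENNReal.ofReal_mul (by positivity)]
    congr 1
    field_simp
  rw [h2, ← ofReal_integral_eq_lintegral_ofReal h_int
    ((ae_restrict_iff' measurableSet_Ioi).2 (ae_of_all _ hnonneg)), hval]
  simp

/-! ### Gaussian noise. -/

instance isProbabilityMeasure_stdComplexGaussian : IsProbabilityMeasure stdComplexGaussian :=
  Measure.isProbabilityMeasure_map Complex.measurableEquivRealProd.symm.measurable.aemeasurable

instance isProbabilityMeasure_noiseLaw (N T : ℕ) : IsProbabilityMeasure (noiseLaw N T) := by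
  unfold noiseLaw
  infer_instance

/-- With variance 1/2 the peak of the density is 1/√π < 1. Hence the noise law can later be replaced
by Lebesgue measure at no cost. -/
lemma gaussianReal_half_le_volume : gaussianReal 0 (1 / 2) ≤ volume := by
  rw [gaussianReal_of_var_ne_zero _ (by norm_num)]
  conv_rhs => rw [← withDensity_one (μ := (volume : Measure ℝ))]
  refine withDensity_mono (ae_of_all _ fun x => ?_)
  rw [Pi.one_apply, gaussianPDF, ← ENNReal.ofReal_one]
  refine ENNReal.ofReal_le_ofReal ?_
  rw [gaussianPDFReal]
  have h1 : (1 : ℝ) ≤ √(2 * Real.pi * ((1 / 2 : NNReal) : ℝ)) := by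
    rw [Real.one_le_sqrt]
    have := Real.pi_gt_three
    push_cast
    linarith
  have h2 : Real.exp (-(x - 0) ^ 2 / (2 * ((1 / 2 : NNReal) : ℝ))) ≤ 1 := by
    rw [Real.exp_le_one_iff]
    push_cast
    have := sq_nonneg (x - 0)
    linarith
  exact mul_le_one₀ (inv_le_one_of_one_le₀ h1) (Real.exp_pos _).le h2

lemma stdComplexGaussian_le_volume : stdComplexGaussian ≤ volume := by
  rw [← Complex.volume_preserving_equiv_real_prod.symm.map_eq]
  exact Measure.map_mono
    (Measure.prod_mono gaussianReal_half_le_volume gaussianReal_half_le_volume)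
    Complex.measurableEquivRealProd.symm.measurable

lemma noiseLaw_le_volume (N T : ℕ) : noiseLaw N T ≤ volume :=
  measure_pi_mono fun _ => measure_pi_mono fun _ => stdComplexGaussian_le_volume

lemma integrable_norm_sq_stdComplexGaussian :
    Integrable (fun z : ℂ => ‖z‖ ^ 2) stdComplexGaussian := by
  have hsq : Integrable (fun x : ℝ => x ^ 2) (gaussianReal 0 (1 / 2)) :=
    (memLp_id_gaussianReal (μ := 0) (v := 1 / 2) 2).integrable_sq
  have hm : Measurable fun p : ℝ × ℝ => (⟨p.1, p.2⟩ : ℂ) :=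
    Complex.measurableEquivRealProd.symm.measurable
  rw [stdComplexGaussian, integrable_map_measure (by fun_prop) hm.aemeasurable]
  refine ((hsq.comp_fst _).add (hsq.comp_snd _)).congr (ae_of_all _ fun p => ?_)
  change p.1 ^ 2 + p.2 ^ 2 = ‖(⟨p.1, p.2⟩ : ℂ)‖ ^ 2
  rw [← Complex.normSq_eq_norm_sq, Complex.normSq_mk]
  ring

lemma integrable_norm_sq_noiseLaw {N T : ℕ} (i : Fin N) (t : Fin T) :
    Integrable (fun z : Fin N → Fin T → ℂ => ‖z i t‖ ^ 2) (noiseLaw N T) := by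
  have h1 : MeasurePreserving (fun z : Fin N → Fin T → ℂ => z i) (noiseLaw N T)
      (Measure.pi fun _ : Fin T => stdComplexGaussian) :=
    measurePreserving_eval (fun _ : Fin N => Measure.pi fun _ : Fin T => stdComplexGaussian) i
  have h2 : MeasurePreserving (fun v : Fin T → ℂ => v t)
      (Measure.pi fun _ : Fin T => stdComplexGaussian) stdComplexGaussian :=
    measurePreserving_eval (fun _ : Fin T => stdComplexGaussian) t
  exact (h2.comp h1).integrable_comp_of_integrable integrable_norm_sq_stdComplexGaussian

/-! ### Calculus of logarithmic sizes. -/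

/-- `log (1 + |a|²)`. -/
noncomputable def logSq (a : ℂ) : ℝ := Real.log (1 + ‖a‖ ^ 2)

lemma logSq_nonneg (a : ℂ) : 0 ≤ logSq a :=
  Real.log_nonneg (by nlinarith [sq_nonneg ‖a‖])

lemma logSq_le (a : ℂ) : logSq a ≤ ‖a‖ ^ 2 := by
  have := Real.log_le_sub_one_of_pos (show 0 < 1 + ‖a‖ ^ 2 by positivity)
  unfold logSq
  linarith

@[fun_prop]
lemma measurable_logSq : Measurable logSq := by
  unfold logSq
  fun_prop

lemma integrable_logSq {Ω : Type*} [MeasurableSpace Ω] {μ : Measure Ω} {f : Ω → ℂ}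
    (hf : Measurable f) (h : Integrable (fun ω => ‖f ω‖ ^ 2) μ) :
    Integrable (fun ω => logSq (f ω)) μ :=
  h.mono' (measurable_logSq.comp hf).aestronglyMeasurable (ae_of_all _ fun ω => by
    rw [Real.norm_of_nonneg (logSq_nonneg _)]
    exact logSq_le _)

lemma logSq_add_le (a b : ℂ) : logSq (a + b) ≤ 1 + logSq a + logSq b := by
  have h2 : Real.log 2 ≤ 1 := by linarith [Real.log_two_lt_d9]
  have : logSq (a + b) ≤ Real.log (2 * ((1 + ‖a‖ ^ 2) * (1 + ‖b‖ ^ 2))) := by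
    refine Real.log_le_log (by positivity) ?_
    have h1 := norm_add_le a b
    have h3 : ‖a + b‖ ^ 2 ≤ (‖a‖ + ‖b‖) ^ 2 := by gcongr
    nlinarith [sq_nonneg (‖a‖ - ‖b‖), sq_nonneg (‖a‖ * ‖b‖)]
  rw [Real.log_mul two_ne_zero (by positivity), Real.log_mul (by positivity) (by positivity)]
    at this
  unfold logSq at *
  linarith

lemma logSq_mul_le (a b : ℂ) : logSq (a * b) ≤ logSq a + logSq b := by
  unfold logSq
  rw [← Real.log_mul (by positivity) (by positivity)]
  refine Real.log_le_log (by positivity) ?_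
  rw [norm_mul]
  nlinarith [sq_nonneg ‖a‖, sq_nonneg ‖b‖]

lemma logSq_div_le (a : ℂ) {b : ℂ} (hb : b ≠ 0) :
    logSq (a / b) ≤ logSq a + logSq b + 2 * max (-Real.log ‖b‖) 0 := by
  have hb' : 0 < ‖b‖ := norm_pos_iff.2 hb
  have h1 : logSq (a / b) ≤ Real.log ((1 + ‖a‖ ^ 2) * (1 + ‖b‖ ^ 2) / ‖b‖ ^ 2) := by
    refine Real.log_le_log (by positivity) ?_
    rw [norm_div, le_div_iff₀ (by positivity)]
    have : (1 + (‖a‖ / ‖b‖) ^ 2) * ‖b‖ ^ 2 = ‖b‖ ^ 2 + ‖a‖ ^ 2 := by field_simp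
    rw [this]
    nlinarith [sq_nonneg (‖a‖ * ‖b‖)]
  rw [Real.log_div (by positivity) (by positivity), Real.log_mul (by positivity) (by positivity),
    Real.log_pow] at h1
  have h2 := le_max_left (-Real.log ‖b‖) 0
  unfold logSq at *
  push_cast at h1
  linarith

/-- Densities are written as exp(-cost), so that products of densities become sums of costs. -/
lemma heavyTail_eq_exp {δ : ℝ} (hδ : 0 < δ) (a : ℂ) :
    heavyTail δ a =
      ENNReal.ofReal (Real.exp (-(Real.log Real.pi + Real.log (1 / δ) + (1 + δ) * logSq a))) := by
  have hpi := Real.pi_pos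
  have h1 : 0 < 1 + ‖a‖ ^ 2 := by positivity
  rw [heavyTail, logSq]
  congr 1
  rw [← Real.exp_log (show 0 < δ / Real.pi * (1 + ‖a‖ ^ 2) ^ (-(1 + δ)) by positivity),
    Real.log_mul (by positivity) (by positivity), Real.log_rpow h1,
    Real.log_div hδ.ne' hpi.ne', one_div, Real.log_inv]
  congr 1
  ring

lemma prod_ofReal_exp_neg {ι : Type*} (s : Finset ι) (c : ι → ℝ) :
    ∏ i ∈ s, ENNReal.ofReal (Real.exp (-c i)) = ENNReal.ofReal (Real.exp (-∑ i ∈ s, c i)) := by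
  rw [← ENNReal.ofReal_prod_of_nonneg fun _ _ => (Real.exp_pos _).le, ← Real.exp_sum,
    Finset.sum_neg_distrib]

lemma log_pi_le_two : Real.log Real.pi ≤ 2 := by
  rw [Real.log_le_iff_le_exp Real.pi_pos]
  have h1 := Real.exp_one_gt_d9
  have h2 : Real.exp 2 = Real.exp 1 * Real.exp 1 := by rw [← Real.exp_add]; norm_num
  have := Real.pi_le_four
  nlinarith

/-! ### Consequences of finite entropy for the fading law. -/

/-- The positive part of the logarithm (in nats) of the density of `μ`. -/
noncomputable def posLogDensity {E : Type*} [MeasureSpace E] (μ : Measure E) (h : E) : ℝ :=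
  max (Real.log (μ.rnDeriv volume h).toReal) 0

@[fun_prop]
lemma measurable_posLogDensity {E : Type*} [MeasureSpace E] (μ : Measure E) :
    Measurable (posLogDensity μ) := by
  unfold posLogDensity
  fun_prop

lemma posLogDensity_nonneg {E : Type*} [MeasureSpace E] (μ : Measure E) (h : E) :
    0 ≤ posLogDensity μ h := le_max_right _ _

lemma absolutelyContinuous_of_bot_lt_diffEntropy {E : Type*} [MeasureSpace E] {μ : Measure E}
    (h : ⊥ < diffEntropy μ) : μ ≪ volume := by
  by_contra hc
  simp [diffEntropy, hc] at h

/-- In `EReal`, subtracting ∞ from anything gives -∞, so an infinite negative part of the entropy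
integral would contradict `h`. -/
lemma integrable_posLogDensity {E : Type*} [MeasureSpace E] {μ : Measure E}
    (h : ⊥ < diffEntropy μ) : Integrable (posLogDensity μ) μ := by
  have hac := absolutelyContinuous_of_bot_lt_diffEntropy h
  have hlog : 0 < Real.log 2 := Real.log_pos one_lt_two
  have hfin : ∫⁻ y, ENNReal.ofReal (Real.logb 2 (μ.rnDeriv volume y).toReal) ∂μ ≠ ∞ := by
    intro htop
    simp [diffEntropy, hac, htop] at h
  refine (lintegral_ofReal_ne_top_iff_integrable (by fun_prop)
    (ae_of_all _ (posLogDensity_nonneg μ))).1 ?_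
  have heq : ∀ y, ENNReal.ofReal (posLogDensity μ y) =
      ENNReal.ofReal (Real.log 2) * ENNReal.ofReal (Real.logb 2 (μ.rnDeriv volume y).toReal) := by
    intro y
    rw [← ENNReal.ofReal_mul hlog.le, Real.logb, mul_div_cancel₀ _ hlog.ne', posLogDensity,
      ENNReal.ofReal_max, ENNReal.ofReal_zero, max_eq_left zero_le]
  simp_rw [heq]
  rw [lintegral_const_mul' _ _ ENNReal.ofReal_ne_top]
  exact ENNReal.mul_ne_top ENNReal.ofReal_ne_top hfin

/-- For a density p, p · exp(-log⁺ p) = min(p, 1) ≤ 1. The cost log⁺ p is thus the price for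
replacing the fading law by Lebesgue measure. -/
lemma lintegral_mul_exp_neg_posLogDensity_le {E : Type*} [MeasureSpace E]
    [SigmaFinite (volume : Measure E)] {μ : Measure E} [IsFiniteMeasure μ] (hac : μ ≪ volume)
    {F : E → ℝ≥0∞} (hF : Measurable F) :
    ∫⁻ h, F h * ENNReal.ofReal (Real.exp (-posLogDensity μ h)) ∂μ ≤ ∫⁻ h, F h := by
  have hm : Measurable fun h => F h * ENNReal.ofReal (Real.exp (-posLogDensity μ h)) := by
    fun_prop
  rw [← lintegral_rnDeriv_mul hac hm.aemeasurable]
  refine lintegral_mono_ae ?_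
  filter_upwards [Measure.rnDeriv_lt_top μ volume] with h htop
  rw [mul_left_comm]
  refine mul_le_of_le_one_right' ?_
  rw [← ENNReal.ofReal_toReal htop.ne, ← ENNReal.ofReal_mul ENNReal.toReal_nonneg,
    ← ENNReal.ofReal_one]
  refine ENNReal.ofReal_le_ofReal ?_
  rcases (ENNReal.toReal_nonneg (a := μ.rnDeriv volume h)).eq_or_lt with h0 | h0
  · rw [← h0, zero_mul]; exact zero_le_one
  · rw [Real.exp_neg, ← div_eq_mul_inv, div_le_one (Real.exp_pos _)]
    calc (μ.rnDeriv volume h).toReal = Real.exp (Real.log (μ.rnDeriv volume h).toReal) :=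
          (Real.exp_log h0).symm
      _ ≤ _ := Real.exp_le_exp.2 (le_max_left _ _)

lemma integrable_norm_sq_apply {n : ℕ} {μ : Measure (Fin n → ℂ)}
    (hmom : ∫⁻ h, ENNReal.ofReal (normSq h) ∂μ < ⊤) (i : Fin n) :
    Integrable (fun h => ‖h i‖ ^ 2) μ := by
  refine (lintegral_ofReal_ne_top_iff_integrable
    (Measurable.aestronglyMeasurable (by fun_prop)) (ae_of_all _ fun h => by positivity)).1 ?_
  refine ((lintegral_mono fun h => ENNReal.ofReal_le_ofReal ?_).trans_lt hmom).ne
  exact Finset.single_le_sum (f := fun i => ‖h i‖ ^ 2) (fun _ _ => by positivity)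
    (Finset.mem_univ i)

/-- The area element r dr cancels the singularity 1/r at the origin. -/
lemma lintegral_inv_norm_ball_lt_top :
    ∫⁻ a : ℂ, ENNReal.ofReal (if ‖a‖ < 1 then ‖a‖⁻¹ else 0) < ∞ := by
  have hm : Measurable fun r : ℝ => ENNReal.ofReal (if r < 1 then r⁻¹ else 0) :=
    (Measurable.ite measurableSet_Iio measurable_inv measurable_const).ennreal_ofReal
  rw [lintegral_comp_norm (f := fun r : ℝ => ENNReal.ofReal (if r < 1 then r⁻¹ else 0)) hm]
  refine ENNReal.mul_lt_top ENNReal.ofReal_lt_top ?_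
  calc ∫⁻ r in Set.Ioi (0 : ℝ), ENNReal.ofReal r * ENNReal.ofReal (if r < 1 then r⁻¹ else 0)
      ≤ ∫⁻ r in Set.Ioi (0 : ℝ), (Set.Iio (1 : ℝ)).indicator 1 r := by
        refine setLIntegral_mono (measurable_one.indicator measurableSet_Iio) fun r hr => ?_
        have hr' : (0 : ℝ) < r := hr
        by_cases h : r < 1
        · simp [h, ← ENNReal.ofReal_mul hr'.le, mul_inv_cancel₀ hr'.ne']
        · simp [h]
    _ = volume (Set.Iio (1 : ℝ) ∩ Set.Ioi 0) := by
        rw [lintegral_indicator_one measurableSet_Iio, Measure.restrict_apply measurableSet_Iio]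
    _ < ∞ := by
        rw [Set.inter_comm, Set.Ioi_inter_Iio, Real.volume_Ioo]
        exact ENNReal.ofReal_lt_top

/-- Finite entropy and finite second moment keep a coordinate logarithmically away from zero. -/
lemma integrable_negLog_norm {n : ℕ} {μ : Measure (Fin (n + 1) → ℂ)} [IsProbabilityMeasure μ]
    (hent : ⊥ < diffEntropy μ) (hmom : ∫⁻ h, ENNReal.ofReal (normSq h) ∂μ < ⊤) :
    Integrable (fun h => max (-Real.log ‖h 0‖) 0) μ := by
  have hac := absolutelyContinuous_of_bot_lt_diffEntropy hent
  -- Cost of a product of `heavyTail 1` on the other coordinates, left unsimplified so as to match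
  -- `heavyTail_eq_exp` at δ = 1.
  set M : (Fin (n + 1) → ℂ) → ℝ := fun h =>
    ∑ i : Fin n, (Real.log Real.pi + Real.log (1 / 1) + (1 + 1) * logSq (h i.succ)) with hM
  have iM : Integrable M μ := integrable_finsetSum _ fun i _ =>
    (integrable_const _).add
      ((integrable_logSq (by fun_prop) (integrable_norm_sq_apply hmom i.succ)).const_mul _)
  have hMm : Measurable M := by fun_prop
  have hite : Measurable fun a : ℂ => ENNReal.ofReal (if ‖a‖ < 1 then ‖a‖⁻¹ else 0) :=
    (Measurable.ite (measurableSet_lt (by fun_prop) (by fun_prop)) (by fun_prop)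
      measurable_const).ennreal_ofReal
  -- A Lebesgue-integrable weight that blows up as h_0 → 0. For p the density of `μ`, θ/p has finite
  -- mean, and its logarithm controls -log‖h_0‖.
  set θ : (Fin (n + 1) → ℂ) → ℝ≥0∞ := fun h =>
    ENNReal.ofReal (if ‖h 0‖ < 1 then ‖h 0‖⁻¹ else 0) * ENNReal.ofReal (Real.exp (-M h)) with hθ
  have hθm : Measurable θ := (hite.comp (measurable_pi_apply 0)).mul (by fun_prop)
  have hθfin : ∫⁻ h, θ h < ∞ := by
    rw [lintegral_fin_succ hθm]
    have : ∀ a : ℂ, ∫⁻ v : Fin n → ℂ, θ (Fin.cons a v : Fin (n + 1) → ℂ) =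
        ENNReal.ofReal (if ‖a‖ < 1 then ‖a‖⁻¹ else 0) := by
      intro a
      simp only [hθ, hM, Fin.cons_zero, Fin.cons_succ, ← prod_ofReal_exp_neg,
        ← heavyTail_eq_exp one_pos]
      rw [lintegral_const_mul _ (by fun_prop), lintegral_fin_prod fun _ => measurable_heavyTail 1]
      simp [lintegral_heavyTail one_pos]
    simp_rw [this]
    exact lintegral_inv_norm_ball_lt_top
  set p := μ.rnDeriv volume with hp
  have hpm : Measurable p := Measure.measurable_rnDeriv _ _
  have h_int : ∫⁻ h, θ h * (p h)⁻¹ ∂μ ≤ ∫⁻ h, θ h := by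
    rw [← lintegral_rnDeriv_mul (f := fun h => θ h * (p h)⁻¹) hac (hθm.mul hpm.inv).aemeasurable]
    refine lintegral_mono fun h => ?_
    rw [mul_left_comm]
    exact mul_le_of_le_one_right' (ENNReal.mul_inv_le_one _)
  have iθ : Integrable (fun h => (θ h * (p h)⁻¹).toReal) μ :=
    integrable_toReal_of_lintegral_ne_top (hθm.mul hpm.inv).aemeasurable (h_int.trans_lt hθfin).ne
  -- The factor 2 undoes the square root below: the logarithm is taken of ‖h_0‖^{-1/2} e^{-M}/p,
  -- which is at most θ/p.
  refine (((integrable_posLogDensity hent).add iM).add iθ |>.const_mul 2).mono'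
    (Measurable.aestronglyMeasurable (by fun_prop)) ?_
  have hMnonneg : ∀ h, 0 ≤ M h := fun h => Finset.sum_nonneg fun i _ => by
    have := logSq_nonneg (h i.succ)
    have := Real.log_nonneg (show 1 ≤ Real.pi by linarith [Real.pi_gt_three])
    simp only [div_one, Real.log_one]
    linarith
  filter_upwards [Measure.rnDeriv_pos hac, hac.ae_le (Measure.rnDeriv_lt_top μ volume)]
    with h h1 h2
  have hpr : 0 < (p h).toReal := ENNReal.toReal_pos h1.ne' h2.ne
  have hnn : (0 : ℝ) ≤ (θ h * (p h)⁻¹).toReal := ENNReal.toReal_nonneg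
  have hpl := posLogDensity_nonneg μ h
  have hM0 := hMnonneg h
  rw [Real.norm_of_nonneg (le_max_right _ _)]
  simp only [Pi.add_apply]
  refine max_le ?_ (by linarith)
  by_cases hu : 0 < ‖h 0‖ ∧ ‖h 0‖ < 1
  · obtain ⟨hu0, hu1⟩ := hu
    have hval : (θ h * (p h)⁻¹).toReal = ‖h 0‖⁻¹ * Real.exp (-M h) * (p h).toReal⁻¹ := by
      rw [ENNReal.toReal_mul, ENNReal.toReal_inv, hθ]
      simp only [hu1, if_true]
      rw [ENNReal.toReal_mul, ENNReal.toReal_ofReal (by positivity),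
        ENNReal.toReal_ofReal (Real.exp_pos _).le]
    have hs0 : 0 < √‖h 0‖ := Real.sqrt_pos.2 hu0
    have hs : (√‖h 0‖)⁻¹ ≤ ‖h 0‖⁻¹ := by
      refine inv_anti₀ hu0 ?_
      exact Real.le_sqrt_of_sq_le (by nlinarith)
    have hlog := Real.log_le_sub_one_of_pos
      (show 0 < (√‖h 0‖)⁻¹ * Real.exp (-M h) * (p h).toReal⁻¹ by positivity)
    rw [Real.log_mul (by positivity) (by positivity), Real.log_mul (by positivity) (by positivity),
      Real.log_exp, Real.log_inv, Real.log_inv, Real.log_sqrt hu0.le] at hlog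
    have hle : (√‖h 0‖)⁻¹ * Real.exp (-M h) * (p h).toReal⁻¹ ≤
        ‖h 0‖⁻¹ * Real.exp (-M h) * (p h).toReal⁻¹ := by gcongr
    have hpos : Real.log (p h).toReal ≤ posLogDensity μ h := le_max_left _ _
    rw [hval]
    linarith
  -- Either ‖h_0‖ ≥ 1, or ‖h_0‖ = 0 and `Real.log 0 = 0`.
  · have : 0 ≤ Real.log ‖h 0‖ := by
      rcases (norm_nonneg (h 0)).eq_or_lt with h0 | h0
      · simp [← h0]
      · exact Real.log_nonneg (not_lt.1 fun h3 => hu ⟨h0, h3⟩)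
    linarith

/-! ### Auxiliary densities and their marginals. -/

/-- Auxiliary joint density of a ratio `a` of two fading coefficients and a row `y` of the output,
given the reference row `y₀`: the row `y` is close to `a y₀`. -/
noncomputable def rowDensity {T : ℕ} (y₀ y : Fin T → ℂ) (a : ℂ) : ℝ≥0∞ :=
  heavyTail 1 a * ∏ t, heavyTail 1 (y t - a * y₀ t)

/-- Auxiliary output density: heavy-tailed first row, the other rows near multiples of it. -/
noncomputable def outputDensity {n T : ℕ} (δ : ℝ) (y : Fin (n + 1) → Fin T → ℂ) : ℝ≥0∞ :=
  (∏ t, heavyTail δ (y 0 t)) * ∏ i : Fin n, ∫⁻ a, rowDensity (y 0) (y i.succ) a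

/-- Auxiliary density of the first fading coefficient `h₀`, given the input and the first row. -/
noncomputable def gainDensity {T : ℕ} (x y₀ : Fin T → ℂ) (h₀ : ℂ) : ℝ≥0∞ :=
  ENNReal.ofReal (1 + normSq x) *
    heavyTail 1 (√(1 + normSq x) * h₀ + -((∑ t, star (x t) * y₀ t) / √(1 + normSq x)))

/-- Auxiliary joint density of fading vector and output, given the input `x`. Its output marginal
`outputDensity` does not depend on `x`. -/
noncomputable def latentDensity {n T : ℕ} (δ : ℝ) (x : Fin T → ℂ) (h : Fin (n + 1) → ℂ)
    (y : Fin (n + 1) → Fin T → ℂ) : ℝ≥0∞ :=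
  (∏ t, heavyTail δ (y 0 t)) *
    (∏ i : Fin n, ENNReal.ofReal (‖h 0‖ ^ 2)⁻¹ * rowDensity (y 0) (y i.succ) (h i.succ / h 0)) *
    gainDensity x (y 0) (h 0)

lemma normSq_nonneg {n : ℕ} (v : Fin n → ℂ) : 0 ≤ normSq v :=
  Finset.sum_nonneg fun _ _ => by positivity

@[fun_prop]
lemma measurable_normSq {n : ℕ} : Measurable (normSq (n := n)) := by
  unfold normSq
  fun_prop

@[fun_prop]
lemma measurable_rowDensity {T : ℕ} {Ω : Type*} [MeasurableSpace Ω] {f g : Ω → Fin T → ℂ}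
    {a : Ω → ℂ} (hf : Measurable f) (hg : Measurable g) (ha : Measurable a) :
    Measurable fun ω => rowDensity (f ω) (g ω) (a ω) := by
  unfold rowDensity
  fun_prop

lemma measurable_lintegral_rowDensity {T : ℕ} {Ω : Type*} [MeasurableSpace Ω]
    {f g : Ω → Fin T → ℂ} (hf : Measurable f) (hg : Measurable g) :
    Measurable fun ω => ∫⁻ a, rowDensity (f ω) (g ω) a :=
  Measurable.lintegral_prod_right' (f := fun p : Ω × ℂ => rowDensity (f p.1) (g p.1) p.2)
    (measurable_rowDensity (hf.comp measurable_fst) (hg.comp measurable_fst) measurable_snd)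

lemma measurable_outputDensity {n T : ℕ} (δ : ℝ) :
    Measurable (outputDensity (n := n) (T := T) δ) := by
  unfold outputDensity
  refine Measurable.mul (by fun_prop) (Finset.measurable_fun_prod _ fun i _ => ?_)
  exact measurable_lintegral_rowDensity (by fun_prop) (by fun_prop)

@[fun_prop]
lemma measurable_latentDensity {n T : ℕ} (δ : ℝ) {Ω : Type*} [MeasurableSpace Ω]
    {x : Ω → Fin T → ℂ} {h : Ω → Fin (n + 1) → ℂ} {y : Ω → Fin (n + 1) → Fin T → ℂ}
    (hx : Measurable x) (hh : Measurable h) (hy : Measurable y) :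
    Measurable fun ω => latentDensity δ (x ω) (h ω) (y ω) := by
  unfold latentDensity gainDensity
  fun_prop

/-- The density is centred at the regularised estimate ⟨x, y₀⟩/(1+‖x‖²) of h_0. The Jacobian of the
scaling by √(1+‖x‖²) cancels the prefactor. -/
lemma lintegral_gainDensity {T : ℕ} (x y₀ : Fin T → ℂ) : ∫⁻ h₀, gainDensity x y₀ h₀ = 1 := by
  have hx := normSq_nonneg x
  have hs : 0 < √(1 + normSq x) := Real.sqrt_pos.2 (by linarith)
  unfold gainDensity
  rw [lintegral_const_mul _ (by fun_prop), lintegral_comp_mul_add _ (by exact_mod_cast hs.ne'),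
    lintegral_heavyTail one_pos, mul_one, Complex.norm_real, Real.norm_of_nonneg hs.le,
    Real.sq_sqrt (by linarith), ← ENNReal.ofReal_mul (by linarith),
    mul_inv_cancel₀ (by linarith), ENNReal.ofReal_one]

lemma lintegral_lintegral_rowDensity {T : ℕ} (y₀ : Fin T → ℂ) :
    ∫⁻ y, ∫⁻ a, rowDensity y₀ y a = 1 := by
  rw [lintegral_lintegral_swap (by fun_prop)]
  unfold rowDensity
  have : ∀ a, ∫⁻ y : Fin T → ℂ, heavyTail 1 a * ∏ t, heavyTail 1 (y t - a * y₀ t) =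
      heavyTail 1 a := by
    intro a
    rw [lintegral_const_mul _ (by fun_prop),
      lintegral_fin_prod (f := fun t b => heavyTail 1 (b - a * y₀ t)) (by fun_prop)]
    simp [lintegral_sub_right_eq_self, lintegral_heavyTail one_pos]
  simp_rw [this]
  exact lintegral_heavyTail one_pos

lemma lintegral_outputDensity {n T : ℕ} {δ : ℝ} (hδ : 0 < δ) :
    ∫⁻ y, outputDensity (n := n) (T := T) δ y = 1 := by
  rw [lintegral_fin_succ (measurable_outputDensity δ)]
  simp only [outputDensity, Fin.cons_zero, Fin.cons_succ]
  have : ∀ y₀ : Fin T → ℂ, ∫⁻ v : Fin n → Fin T → ℂ,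
      (∏ t, heavyTail δ (y₀ t)) * ∏ i : Fin n, ∫⁻ a, rowDensity y₀ (v i) a =
      ∏ t, heavyTail δ (y₀ t) := by
    intro y₀
    rw [lintegral_const_mul _ (Finset.measurable_fun_prod _ fun i _ =>
        measurable_lintegral_rowDensity (by fun_prop) (by fun_prop)),
      lintegral_fin_prod (f := fun _ w => ∫⁻ a, rowDensity y₀ w a) fun i =>
        measurable_lintegral_rowDensity (by fun_prop) (by fun_prop)]
    simp [lintegral_lintegral_rowDensity]
  simp_rw [this]
  rw [lintegral_fin_prod fun _ => measurable_heavyTail δ]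
  simp [lintegral_heavyTail hδ]

/-- For fixed h_0 ≠ 0, the substitution a = h_i/h_0 has a Jacobian that cancels ‖h_0‖^{-2} and
leaves the row mixtures of `outputDensity`. Then h_0 integrates out by `lintegral_gainDensity`, and
with it all dependence on x. -/
lemma lintegral_latentDensity {n T : ℕ} (δ : ℝ) (x : Fin T → ℂ) (y : Fin (n + 1) → Fin T → ℂ) :
    ∫⁻ h, latentDensity δ x h y = outputDensity δ y := by
  rw [lintegral_fin_succ (by fun_prop)]
  simp only [latentDensity, Fin.cons_zero, Fin.cons_succ]
  have hg : Measurable (gainDensity x (y 0)) := by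
    unfold gainDensity
    fun_prop
  have key : ∀ h₀ : ℂ, h₀ ≠ 0 → ∫⁻ v : Fin n → ℂ, (∏ t, heavyTail δ (y 0 t)) *
      (∏ i : Fin n, ENNReal.ofReal (‖h₀‖ ^ 2)⁻¹ * rowDensity (y 0) (y i.succ) (v i / h₀)) *
      gainDensity x (y 0) h₀ = outputDensity δ y * gainDensity x (y 0) h₀ := by
    intro h₀ hh₀
    have hpos : 0 < ‖h₀‖ ^ 2 := by positivity
    rw [lintegral_mul_const _ (by fun_prop), lintegral_const_mul _ (by fun_prop),
      lintegral_fin_prod (f := fun i b => ENNReal.ofReal (‖h₀‖ ^ 2)⁻¹ *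
        rowDensity (y 0) (y i.succ) (b / h₀)) (by fun_prop), outputDensity]
    congr 2
    refine Finset.prod_congr rfl fun i _ => ?_
    rw [lintegral_const_mul _ (by fun_prop)]
    have := lintegral_comp_mul_add (rowDensity (y 0) (y i.succ)) (inv_ne_zero hh₀) 0
    simp only [add_zero, norm_inv, inv_pow, inv_inv] at this
    simp_rw [div_eq_inv_mul]
    rw [this, ← mul_assoc, ← ENNReal.ofReal_mul (by positivity), inv_mul_cancel₀ hpos.ne',
      ENNReal.ofReal_one, one_mul]
  have hae : ∀ᵐ h₀ : ℂ, h₀ ≠ 0 := Measure.ae_ne volume 0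
  rw [lintegral_congr_ae (hae.mono key), lintegral_const_mul _ hg, lintegral_gainDensity, mul_one]

/-- A tilt dominated by the latent density maps the channel below the auxiliary output law. -/
lemma lintegral_channel_le {n T : ℕ} {μH : Measure (Fin (n + 1) → ℂ)} [IsProbabilityMeasure μH]
    (hac : μH ≪ volume) {δ : ℝ} (x : Fin T → ℂ)
    {ℓ : (Fin (n + 1) → ℂ) → (Fin (n + 1) → Fin T → ℂ) → ℝ}
    (hℓm : Measurable fun p : (Fin (n + 1) → ℂ) × (Fin (n + 1) → Fin T → ℂ) => ℓ p.1 p.2)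
    (hℓ : ∀ h z, h 0 ≠ 0 → ENNReal.ofReal (Real.exp (-ℓ h z)) ≤
      latentDensity δ x h (fun i t => h i * x t + z i t))
    {G : (Fin (n + 1) → Fin T → ℂ) → ℝ≥0∞} (hG : Measurable G) :
    ∫⁻ h, ∫⁻ z, G (fun i t => h i * x t + z i t) *
        ENNReal.ofReal (Real.exp (-(posLogDensity μH h + ℓ h z))) ∂(noiseLaw (n + 1) T) ∂μH
      ≤ ∫⁻ y, G y * outputDensity δ y := by
  have hne : ∀ᵐ h : Fin (n + 1) → ℂ, h 0 ≠ 0 := Measure.ae_eval_ne (μ := fun _ => volume) 0 0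
  have hm : Measurable fun p : (Fin (n + 1) → ℂ) × (Fin (n + 1) → Fin T → ℂ) =>
      G (fun i t => p.1 i * x t + p.2 i t) * ENNReal.ofReal (Real.exp (-ℓ p.1 p.2)) :=
    (hG.comp (by fun_prop)).mul (by fun_prop)
  calc ∫⁻ h, ∫⁻ z, G (fun i t => h i * x t + z i t) *
        ENNReal.ofReal (Real.exp (-(posLogDensity μH h + ℓ h z))) ∂(noiseLaw (n + 1) T) ∂μH
      = ∫⁻ h, (∫⁻ z, G (fun i t => h i * x t + z i t) *
        ENNReal.ofReal (Real.exp (-ℓ h z)) ∂(noiseLaw (n + 1) T)) *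
          ENNReal.ofReal (Real.exp (-posLogDensity μH h)) ∂μH := by
        refine lintegral_congr fun h => ?_
        rw [← lintegral_mul_const _ (by exact hm.comp (measurable_const.prodMk measurable_id))]
        refine lintegral_congr fun z => ?_
        rw [mul_assoc, ← ENNReal.ofReal_mul (Real.exp_pos _).le, ← Real.exp_add]
        congr 3
        ring
    _ ≤ ∫⁻ h, ∫⁻ z : Fin (n + 1) → Fin T → ℂ, G (fun i t => h i * x t + z i t) *
        ENNReal.ofReal (Real.exp (-ℓ h z)) ∂(noiseLaw (n + 1) T) :=
        lintegral_mul_exp_neg_posLogDensity_le hac hm.lintegral_prod_right'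
    _ ≤ ∫⁻ h, ∫⁻ z : Fin (n + 1) → Fin T → ℂ, G (fun i t => h i * x t + z i t) *
        latentDensity δ x h (fun i t => h i * x t + z i t) := by
        refine lintegral_mono_ae (hne.mono fun h hh => ?_)
        refine (lintegral_mono' (noiseLaw_le_volume _ _) le_rfl).trans ?_
        exact lintegral_mono fun z => mul_le_mul_right (hℓ h z hh) _
    _ = ∫⁻ h, ∫⁻ y, G y * latentDensity δ x h y := by
        refine lintegral_congr fun h => ?_
        -- With the noise law replaced by Lebesgue measure, translation by the signal h xᵀ turns
        -- noise into output.
        exact lintegral_add_left_eq_self (μ := volume)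
          (fun y : Fin (n + 1) → Fin T → ℂ => G y * latentDensity δ x h y) (fun i t => h i * x t)
    _ = ∫⁻ y, ∫⁻ h, G y * latentDensity δ x h y :=
        lintegral_lintegral_swap (by fun_prop)
    _ = ∫⁻ y, G y * outputDensity δ y := by
        refine lintegral_congr fun y => ?_
        rw [lintegral_const_mul _ (by fun_prop), lintegral_latentDensity]

/-! ### Pointwise cost of the auxiliary density. -/

lemma log_one_add_normSq_le {n : ℕ} (v : Fin n → ℂ) :
    Real.log (1 + normSq v) ≤ ∑ i, logSq (v i) := by
  unfold normSq logSq
  rw [← Real.log_prod fun i _ => by positivity]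
  refine Real.log_le_log (by positivity) ?_
  have key : ∀ s : Finset (Fin n), 1 + ∑ i ∈ s, ‖v i‖ ^ 2 ≤ ∏ i ∈ s, (1 + ‖v i‖ ^ 2) := by
    intro s
    induction s using Finset.induction_on with
    | empty => simp
    | insert i s hi ih =>
      rw [Finset.sum_insert hi, Finset.prod_insert hi]
      have h1 : 0 ≤ ‖v i‖ ^ 2 := by positivity
      have h2 : 0 ≤ ∑ i ∈ s, ‖v i‖ ^ 2 := Finset.sum_nonneg fun _ _ => by positivity
      nlinarith
  exact key Finset.univ

/-- The channel-independent part of the cost: logarithmic sizes of fading and noise. -/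
noncomputable def latentCost {n T : ℕ} (h : Fin (n + 1) → ℂ) (z : Fin (n + 1) → Fin T → ℂ) : ℝ :=
  ∑ i, logSq (h i) + ∑ i, ∑ t, logSq (z i t) + max (-Real.log ‖h 0‖) 0

lemma sum_logSq_nonneg {n T : ℕ} (z : Fin n → Fin T → ℂ) : 0 ≤ ∑ i, ∑ t, logSq (z i t) :=
  Finset.sum_nonneg fun _ _ => Finset.sum_nonneg fun _ _ => logSq_nonneg _

section Bounds

variable {n T : ℕ} (h : Fin (n + 1) → ℂ) (z : Fin (n + 1) → Fin T → ℂ)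

lemma logSq_fading_le_latentCost (i : Fin (n + 1)) : logSq (h i) ≤ latentCost h z := by
  have h1 := Finset.single_le_sum (f := fun i => logSq (h i)) (fun i _ => logSq_nonneg _)
    (Finset.mem_univ i)
  have h2 := sum_logSq_nonneg z
  have h3 := le_max_right (-Real.log ‖h 0‖) 0
  unfold latentCost
  linarith

lemma sum_logSq_noise_le (i : Fin (n + 1)) :
    ∑ t, logSq (z i t) ≤ ∑ i, ∑ t, logSq (z i t) :=
  Finset.single_le_sum (f := fun i => ∑ t, logSq (z i t))
    (fun _ _ => Finset.sum_nonneg fun _ _ => logSq_nonneg _) (Finset.mem_univ i)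

lemma logSq_noise_le_latentCost (i : Fin (n + 1)) (t : Fin T) :
    logSq (z i t) ≤ latentCost h z := by
  have h0 := Finset.single_le_sum (f := fun t => logSq (z i t)) (fun t _ => logSq_nonneg _)
    (Finset.mem_univ t)
  have h1 := sum_logSq_noise_le z i
  have h2 : 0 ≤ ∑ i, logSq (h i) := Finset.sum_nonneg fun _ _ => logSq_nonneg _
  have h3 := le_max_right (-Real.log ‖h 0‖) 0
  unfold latentCost
  linarith

lemma negLog_le_latentCost : max (-Real.log ‖h 0‖) 0 ≤ latentCost h z := by
  have h1 := sum_logSq_nonneg z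
  have h2 : 0 ≤ ∑ i, logSq (h i) := Finset.sum_nonneg fun _ _ => logSq_nonneg _
  unfold latentCost
  linarith

lemma logSq_add_sum_le_latentCost : logSq (h 0) + ∑ t, logSq (z 0 t) ≤ latentCost h z := by
  have h0 := Finset.single_le_sum (f := fun i => logSq (h i)) (fun i _ => logSq_nonneg _)
    (Finset.mem_univ 0)
  have h1 := sum_logSq_noise_le z 0
  have h3 := le_max_right (-Real.log ‖h 0‖) 0
  unfold latentCost
  linarith

lemma latentCost_nonneg : 0 ≤ latentCost h z :=
  (logSq_nonneg _).trans (logSq_fading_le_latentCost h z 0)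

end Bounds

/-- Cauchy-Schwarz for the whitened estimate of the first fading coefficient. -/
lemma logSq_whitened_le {T : ℕ} (x z : Fin T → ℂ) (h₀ : ℂ) :
    logSq (√(1 + normSq x) * h₀ +
      -((∑ t, star (x t) * (h₀ * x t + z t)) / √(1 + normSq x))) ≤
      logSq h₀ + ∑ t, logSq (z t) := by
  have hx := normSq_nonneg x
  have hz := normSq_nonneg z
  have hspos : 0 < √(1 + normSq x) := Real.sqrt_pos.2 (by linarith)
  have hs2 : √(1 + normSq x) ^ 2 = 1 + normSq x := Real.sq_sqrt (by linarith)
  have hsc : (√(1 + normSq x) : ℂ) ≠ 0 := by exact_mod_cast hspos.ne'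
  have hs2c : (√(1 + normSq x) : ℂ) ^ 2 = 1 + normSq x := by exact_mod_cast hs2
  have hsum : ∑ t, star (x t) * (h₀ * x t + z t) =
      normSq x * h₀ + ∑ t, star (x t) * z t := by
    have : (normSq x : ℂ) = ∑ t, star (x t) * x t := by
      rw [normSq, Complex.ofReal_sum]
      refine Finset.sum_congr rfl fun t _ => ?_
      rw [Complex.star_def, Complex.conj_mul', Complex.ofReal_pow]
    rw [this, Finset.sum_mul, ← Finset.sum_add_distrib]
    exact Finset.sum_congr rfl fun t _ => by ring
  -- The estimation error contains h_0 only through the regularising 1, so the normalised error does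
  -- not grow with ‖x‖.
  have heq : (√(1 + normSq x) : ℂ) * h₀ +
      -((∑ t, star (x t) * (h₀ * x t + z t)) / √(1 + normSq x)) =
      (h₀ - ∑ t, star (x t) * z t) / √(1 + normSq x) := by
    rw [hsum]
    field_simp
    rw [hs2c]
    ring
  rw [heq]
  have hcs : ‖∑ t, star (x t) * z t‖ ≤ √(normSq x) * √(normSq z) := by
    refine (norm_sum_le _ _).trans ?_
    rw [← Real.sqrt_mul hx]
    refine Real.le_sqrt_of_sq_le ?_
    simp only [norm_mul, norm_star]
    exact Finset.sum_mul_sq_le_sq_mul_sq _ _ _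
  have hbound : ‖(h₀ - ∑ t, star (x t) * z t) / (√(1 + normSq x) : ℂ)‖ ^ 2 ≤
      ‖h₀‖ ^ 2 + normSq z := by
    rw [norm_div, Complex.norm_real, Real.norm_of_nonneg hspos.le, div_pow, hs2,
      div_le_iff₀ (by linarith)]
    have h1 : ‖h₀ - ∑ t, star (x t) * z t‖ ≤ ‖h₀‖ + √(normSq x) * √(normSq z) :=
      (norm_sub_le _ _).trans (by linarith)
    have h2 : ‖h₀ - ∑ t, star (x t) * z t‖ ^ 2 ≤ (‖h₀‖ + √(normSq x) * √(normSq z)) ^ 2 := by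
      gcongr
    have hX := Real.sq_sqrt hx
    have hZ := Real.sq_sqrt hz
    have h3 := sq_nonneg (√(normSq x) * ‖h₀‖ - √(normSq z))
    have e1 : (√(normSq x) * ‖h₀‖) ^ 2 = normSq x * ‖h₀‖ ^ 2 := by rw [mul_pow, hX]
    have e2 : (√(normSq x) * √(normSq z)) ^ 2 = normSq x * normSq z := by rw [mul_pow, hX, hZ]
    nlinarith
  calc logSq ((h₀ - ∑ t, star (x t) * z t) / (√(1 + normSq x) : ℂ))
      ≤ Real.log ((1 + ‖h₀‖ ^ 2) * (1 + normSq z)) := by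
        refine Real.log_le_log (by positivity) ?_
        nlinarith [sq_nonneg ‖h₀‖]
    _ = logSq h₀ + Real.log (1 + normSq z) := by
        rw [Real.log_mul (by positivity) (by linarith), logSq]
    _ ≤ _ := by linarith [log_one_add_normSq_le z]

/-- Upper bound, in nats, for the logarithmic loss of the auxiliary latent density. -/
noncomputable def channelCost {n T : ℕ} (δ : ℝ) (x : Fin T → ℂ) (h : Fin (n + 1) → ℂ)
    (z : Fin (n + 1) → Fin T → ℂ) : ℝ :=
  T * (Real.log (1 / δ) + (1 + δ) * Real.log (1 + normSq x) + (4 + 4 * latentCost h z)) +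
    n * (2 + 9 * latentCost h z + T * (4 + 12 * latentCost h z)) +
    (2 + 2 * latentCost h z - Real.log (1 + normSq x))

lemma ofReal_exp_neg_le {a b : ℝ} (hab : b ≤ a) :
    ENNReal.ofReal (Real.exp (-a)) ≤ ENNReal.ofReal (Real.exp (-b)) :=
  ENNReal.ofReal_le_ofReal (Real.exp_le_exp.2 (neg_le_neg hab))

lemma ofReal_exp_neg_add (a b : ℝ) :
    ENNReal.ofReal (Real.exp (-(a + b))) =
      ENNReal.ofReal (Real.exp (-a)) * ENNReal.ofReal (Real.exp (-b)) := by
  rw [← ENNReal.ofReal_mul (Real.exp_pos _).le, ← Real.exp_add, neg_add]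

lemma ofReal_exp_neg_nsmul_le_prod {m : ℕ} {f : Fin m → ℝ≥0∞} {c : ℝ}
    (hf : ∀ i, ENNReal.ofReal (Real.exp (-c)) ≤ f i) :
    ENNReal.ofReal (Real.exp (-(m * c))) ≤ ∏ i, f i := by
  have h1 := prod_ofReal_exp_neg (Finset.univ : Finset (Fin m)) fun _ => c
  rw [Finset.sum_const, Finset.card_univ, Fintype.card_fin, nsmul_eq_mul] at h1
  rw [← h1]
  exact Finset.prod_le_prod' fun i _ => hf i

lemma ofReal_exp_neg_le_heavyTail {δ : ℝ} (hδ : 0 < δ) {a : ℂ} {c : ℝ}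
    (hc : 2 + Real.log (1 / δ) + (1 + δ) * logSq a ≤ c) :
    ENNReal.ofReal (Real.exp (-c)) ≤ heavyTail δ a := by
  rw [heavyTail_eq_exp hδ]
  exact ofReal_exp_neg_le (by linarith [log_pi_le_two])

lemma ofReal_exp_neg_le_heavyTail_one {a : ℂ} {c : ℝ} (hc : 2 + 2 * logSq a ≤ c) :
    ENNReal.ofReal (Real.exp (-c)) ≤ heavyTail 1 a := by
  refine ofReal_exp_neg_le_heavyTail one_pos ?_
  rw [div_one, Real.log_one]
  linarith

lemma ofReal_exp_neg_channelCost_le {n T : ℕ} {δ : ℝ} (hδ : 0 < δ) (hδ1 : δ ≤ 1)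
    (x : Fin T → ℂ) (h : Fin (n + 1) → ℂ) (z : Fin (n + 1) → Fin T → ℂ) (hh : h 0 ≠ 0) :
    ENNReal.ofReal (Real.exp (-channelCost δ x h z)) ≤
      latentDensity δ x h (fun i t => h i * x t + z i t) := by
  have hx := normSq_nonneg x
  have hS := latentCost_nonneg h z
  have hh0 : 0 < ‖h 0‖ := norm_pos_iff.2 hh
  unfold channelCost latentDensity
  rw [ofReal_exp_neg_add, ofReal_exp_neg_add]
  refine mul_le_mul' (mul_le_mul' ?_ ?_) ?_
  -- First row. Writing S for `latentCost h z`, the constant 4 + 4S is 2 from the bound on log π,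
  -- plus (1+δ)(1 + 2S) with δ ≤ 1.
  · refine ofReal_exp_neg_nsmul_le_prod fun t => ofReal_exp_neg_le_heavyTail hδ ?_
    have h1 := logSq_add_le (h 0 * x t) (z 0 t)
    have h2 := logSq_mul_le (h 0) (x t)
    have h3 : logSq (x t) ≤ Real.log (1 + normSq x) := by
      refine Real.log_le_log (by positivity) ?_
      have := Finset.single_le_sum (f := fun t => ‖x t‖ ^ 2) (fun _ _ => by positivity)
        (Finset.mem_univ t)
      unfold normSq
      linarith
    have h4 := logSq_fading_le_latentCost h z 0
    have h5 := logSq_noise_le_latentCost h z 0 t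
    have h6 : (1 + δ) * logSq (h 0 * x t + z 0 t) ≤
        (1 + δ) * (1 + 2 * latentCost h z + Real.log (1 + normSq x)) := by
      gcongr
      linarith
    nlinarith
  -- Other rows. The 9S is S for the factor ‖h_0‖^{-2} plus 2 · 4S for the tail at the ratio.
  · have hratio : ∀ i : Fin n, logSq (h i.succ / h 0) ≤ 4 * latentCost h z := fun i => by
      have h1 := logSq_div_le (h i.succ) hh
      have h2 := logSq_fading_le_latentCost h z 0
      have h3 := logSq_fading_le_latentCost h z i.succ
      have h4 := negLog_le_latentCost h z
      linarith
    refine ofReal_exp_neg_nsmul_le_prod fun i => ?_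
    rw [show 2 + 9 * latentCost h z + T * (4 + 12 * latentCost h z) =
      latentCost h z + (2 + 8 * latentCost h z + T * (4 + 12 * latentCost h z)) by ring,
      ofReal_exp_neg_add, ofReal_exp_neg_add]
    refine mul_le_mul' ?_ (mul_le_mul' ?_ ?_)
    · refine ENNReal.ofReal_le_ofReal ?_
      rw [Real.exp_neg]
      refine inv_anti₀ (by positivity) ?_
      rw [← Real.log_le_iff_le_exp (by positivity)]
      refine le_trans ?_ (logSq_fading_le_latentCost h z 0)
      exact Real.log_le_log (by positivity) (by linarith)
    · exact ofReal_exp_neg_le_heavyTail_one (by linarith [hratio i])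
    · refine ofReal_exp_neg_nsmul_le_prod fun t => ofReal_exp_neg_le_heavyTail_one ?_
      -- The input cancels and only noise remains, so these rows cost nothing in ‖x‖. The cost is 2
      -- + 2(1 + S + 4S + S) = 4 + 12S.
      have heq : h i.succ * x t + z i.succ t - h i.succ / h 0 * (h 0 * x t + z 0 t) =
          z i.succ t + -(h i.succ / h 0) * z 0 t := by
        field_simp
        ring
      rw [heq]
      have h1 := logSq_add_le (z i.succ t) (-(h i.succ / h 0) * z 0 t)
      have h2 := logSq_mul_le (-(h i.succ / h 0)) (z 0 t)
      have h3 : logSq (-(h i.succ / h 0)) = logSq (h i.succ / h 0) := by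
        unfold logSq
        rw [norm_neg]
      have h4 := logSq_noise_le_latentCost h z i.succ t
      have h5 := logSq_noise_le_latentCost h z 0 t
      have h6 := hratio i
      linarith
  -- The height 1 + ‖x‖² of this factor yields the negative cost -log(1+‖x‖²).
  · rw [gainDensity, show 2 + 2 * latentCost h z - Real.log (1 + normSq x) =
      -Real.log (1 + normSq x) + (2 + 2 * latentCost h z) by ring, ofReal_exp_neg_add, neg_neg,
      Real.exp_log (by linarith)]
    refine mul_le_mul' le_rfl (ofReal_exp_neg_le_heavyTail_one ?_)
    have h1 := logSq_whitened_le x (z 0) (h 0)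
    have h2 := logSq_add_sum_le_latentCost h z
    linarith

/-! ### Expected cost and the bound on the information of one block. -/

@[fun_prop]
lemma measurable_latentCost {n T : ℕ} {Ω : Type*} [MeasurableSpace Ω] {h : Ω → Fin (n + 1) → ℂ}
    {z : Ω → Fin (n + 1) → Fin T → ℂ} (hh : Measurable h) (hz : Measurable z) :
    Measurable fun ω => latentCost (h ω) (z ω) := by
  unfold latentCost
  fun_prop

@[fun_prop]
lemma measurable_channelCost {n T : ℕ} (δ : ℝ) {Ω : Type*} [MeasurableSpace Ω]
    {x : Ω → Fin T → ℂ} {h : Ω → Fin (n + 1) → ℂ} {z : Ω → Fin (n + 1) → Fin T → ℂ}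
    (hx : Measurable x) (hh : Measurable h) (hz : Measurable z) :
    Measurable fun ω => channelCost δ (x ω) (h ω) (z ω) := by
  unfold channelCost
  fun_prop

lemma integrable_latentCost {n T : ℕ} {μH : Measure (Fin (n + 1) → ℂ)} [IsProbabilityMeasure μH]
    (hent : ⊥ < diffEntropy μH) (hmom : ∫⁻ h, ENNReal.ofReal (normSq h) ∂μH < ⊤) :
    Integrable (fun p : (Fin (n + 1) → ℂ) × (Fin (n + 1) → Fin T → ℂ) => latentCost p.1 p.2)
      (μH.prod (noiseLaw (n + 1) T)) := by
  have h1 : Integrable (fun h : Fin (n + 1) → ℂ => ∑ i, logSq (h i)) μH :=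
    integrable_finsetSum _ fun i _ =>
      integrable_logSq (by fun_prop) (integrable_norm_sq_apply hmom i)
  have h2 : Integrable (fun z : Fin (n + 1) → Fin T → ℂ => ∑ i, ∑ t, logSq (z i t))
      (noiseLaw (n + 1) T) :=
    integrable_finsetSum _ fun i _ => integrable_finsetSum _ fun t _ =>
      integrable_logSq (by fun_prop) (integrable_norm_sq_noiseLaw i t)
  exact ((h1.comp_fst _).add (h2.comp_snd _)).add ((integrable_negLog_norm hent hmom).comp_fst _)

/-- Jensen's inequality for the logarithmic input power. -/
lemma integral_log_one_add_normSq_le {T : ℕ} {P : ℝ} (hP : 0 ≤ P) {μX : Measure (Fin T → ℂ)}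
    [IsProbabilityMeasure μX] (h : AveragePower P μX) :
    Integrable (fun x => Real.log (1 + normSq x)) μX ∧
      ∫ x, Real.log (1 + normSq x) ∂μX ≤ Real.log (1 + P * T) := by
  have hM : 0 ≤ P * T := by positivity
  have hsq : Integrable (normSq (n := T)) μX :=
    (lintegral_ofReal_ne_top_iff_integrable measurable_normSq.aestronglyMeasurable
      (ae_of_all _ normSq_nonneg)).1 (ne_top_of_le_ne_top ENNReal.ofReal_ne_top h)
  have hmean : ∫ x, normSq x ∂μX ≤ P * T := by
    rw [integral_eq_lintegral_of_nonneg_ae (ae_of_all _ normSq_nonneg)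
      measurable_normSq.aestronglyMeasurable]
    exact ENNReal.toReal_le_of_le_ofReal hM h
  have h_int : Integrable (fun x => Real.log (1 + normSq x)) μX := by
    refine hsq.mono' (Measurable.aestronglyMeasurable (by fun_prop)) (ae_of_all _ fun x => ?_)
    have hx := normSq_nonneg x
    rw [Real.norm_of_nonneg (Real.log_nonneg (by linarith))]
    linarith [Real.log_le_sub_one_of_pos (show 0 < 1 + normSq x by linarith)]
  refine ⟨h_int, ?_⟩
  -- Tangent line to log at 1 + PT; its linear term has nonpositive mean under the power constraint.
  have hle : ∀ x : Fin T → ℂ, Real.log (1 + normSq x) ≤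
      Real.log (1 + P * T) + (1 + P * T)⁻¹ * (normSq x - P * T) := by
    intro x
    have hx := normSq_nonneg x
    have h1 := Real.log_le_sub_one_of_pos
      (show 0 < (1 + normSq x) / (1 + P * T) by positivity)
    rw [Real.log_div (by positivity) (by positivity)] at h1
    have h2 : (1 + normSq x) / (1 + P * T) - 1 = (1 + P * T)⁻¹ * (normSq x - P * T) := by
      field_simp
      ring
    linarith
  have i1 : Integrable (fun x : Fin T → ℂ => normSq x - P * T) μX :=
    hsq.sub (integrable_const _)
  have h3 := integral_mono h_int ((integrable_const _).add (i1.const_mul _)) hle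
  simp only [Pi.add_apply] at h3
  rw [integral_add (integrable_const _) (i1.const_mul _), integral_const_mul,
    integral_sub hsq (integrable_const _)] at h3
  simp only [integral_const, probReal_univ, one_smul] at h3
  have h4 : (1 + P * T)⁻¹ * (∫ x, normSq x ∂μX - P * T) ≤ 0 :=
    mul_nonpos_of_nonneg_of_nonpos (by positivity) (by linarith)
  linarith

/-- The mutual information of one block, in nats, for every shape parameter `δ`. -/
theorem exists_klDiv_block_le {n : ℕ} (T : ℕ) {μH : Measure (Fin (n + 1) → ℂ)}
    [IsProbabilityMeasure μH] (hT : 1 ≤ T) (hent : ⊥ < diffEntropy μH)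
    (hmom : ∫⁻ h, ENNReal.ofReal (normSq h) ∂μH < ⊤) :
    ∃ K : ℝ, ∀ δ : ℝ, 0 < δ → δ ≤ 1 → ∀ P : ℝ, 0 ≤ P → ∀ μX : Measure (Fin T → ℂ),
      IsProbabilityMeasure μX → AveragePower P μX →
      InformationTheory.klDiv ((sourceLaw μX μH).map fun ω => (input ω, output ω))
          (((sourceLaw μX μH).map input).prod ((sourceLaw μX μH).map output)) ≤
        ENNReal.ofReal (K + T * Real.log (1 / δ) + (T * (1 + δ) - 1) * Real.log (1 + P * T)) := by
  have hac := absolutelyContinuous_of_bot_lt_diffEntropy hent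
  -- All costs free of x and δ are collected here, so K depends on neither P nor the input law.
  set f : (Fin (n + 1) → ℂ) × (Fin (n + 1) → Fin T → ℂ) → ℝ := fun p =>
    posLogDensity μH p.1 + (4 * T + n * (2 + 4 * T) + 2) +
      (4 * T + n * (9 + 12 * T) + 2) * latentCost p.1 p.2 with hf
  have iF : Integrable f (μH.prod (noiseLaw (n + 1) T)) :=
    (((integrable_posLogDensity hent).comp_fst _).add (integrable_const _)).add
      ((integrable_latentCost hent hmom).const_mul _)
  refine ⟨∫ p, f p ∂(μH.prod (noiseLaw (n + 1) T)), fun δ hδ hδ1 P hP μX hX hpow => ?_⟩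
  obtain ⟨iρ, hρ⟩ := integral_log_one_add_normSq_le hP hpow
  set ℓ : (Fin T → ℂ) × (Fin (n + 1) → ℂ) × (Fin (n + 1) → Fin T → ℂ) → ℝ := fun ω =>
    posLogDensity μH ω.2.1 + channelCost δ ω.1 ω.2.1 ω.2.2 with hℓ
  have hℓm : Measurable ℓ := by fun_prop
  have hℓeq : ℓ = fun ω => f ω.2 +
      (T * Real.log (1 / δ) + (T * (1 + δ) - 1) * Real.log (1 + normSq ω.1)) := by
    funext ω
    simp only [hℓ, hf, channelCost]
    ring
  have : IsProbabilityMeasure (sourceLaw μX μH) := by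
    unfold sourceLaw
    infer_instance
  have iX : Integrable (fun x : Fin T → ℂ => T * Real.log (1 / δ) +
      (T * (1 + δ) - 1) * Real.log (1 + normSq x)) μX :=
    (integrable_const _).add (iρ.const_mul _)
  have iℓ : Integrable ℓ (sourceLaw μX μH) := by
    rw [hℓeq]
    exact (iF.comp_snd _).add (iX.comp_fst _)
  have hin : Measurable (input (N := n + 1) (T := T)) := measurable_fst
  have hout : Measurable (output (N := n + 1) (T := T)) := by
    unfold output
    fun_prop
  have hinmap : (sourceLaw μX μH).map input = μX := by
    change (μX.prod _).map Prod.fst = μX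
    simp
  refine (klDiv_map_prod_le (μ := sourceLaw μX μH) hin hout
    (volume.withDensity (outputDensity δ)) ?_ hℓm iℓ ?_).trans ?_
  · rw [withDensity_apply _ .univ, Measure.restrict_univ, lintegral_outputDensity hδ]
  · intro G hG
    rw [hinmap, lintegral_prod _ hG.aemeasurable, sourceLaw, lintegral_prod _ (by
      exact ((hG.comp (hin.prodMk hout)).mul (by fun_prop)).aemeasurable)]
    refine lintegral_mono fun x => ?_
    have hGx : Measurable fun y => G (x, y) := hG.comp (by fun_prop)
    have hm : Measurable fun p : (Fin (n + 1) → ℂ) × (Fin (n + 1) → Fin T → ℂ) =>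
        G (input (x, p), output (x, p)) * ENNReal.ofReal (Real.exp (-ℓ (x, p))) :=
      (hG.comp ((hin.prodMk hout).comp (by fun_prop))).mul (by fun_prop)
    rw [lintegral_prod _ hm.aemeasurable,
      lintegral_withDensity_eq_lintegral_mul _ (measurable_outputDensity δ) hGx]
    simp only [Pi.mul_apply, mul_comm (outputDensity δ _)]
    exact lintegral_channel_le hac x (ℓ := channelCost δ x) (by fun_prop)
      (fun h z hh => ofReal_exp_neg_channelCost_le hδ hδ1 x h z hh) hGx
  · refine ENNReal.ofReal_le_ofReal ?_
    rw [hℓeq, sourceLaw, integral_add (iF.comp_snd _) (iX.comp_fst _)]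
    rw [integral_fun_snd f, integral_fun_fst (fun x : Fin T → ℂ => T * Real.log (1 / δ) +
      (T * (1 + δ) - 1) * Real.log (1 + normSq x)), integral_add (integrable_const _)
      (iρ.const_mul _), integral_const_mul _ fun x : Fin T → ℂ => Real.log (1 + normSq x)]
    simp only [integral_const, probReal_univ, one_smul]
    have hT' : (1 : ℝ) ≤ T := by exact_mod_cast hT
    -- Jensen's bound applies because T ≥ 1 makes the coefficient nonnegative.
    have : (T * (1 + δ) - 1) * ∫ x, Real.log (1 + normSq x) ∂μX ≤
        (T * (1 + δ) - 1) * Real.log (1 + P * T) :=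
      mul_le_mul_of_nonneg_left hρ (by nlinarith)
    linarith

/-- High-SNR bound on the mutual information of one block, in bits. -/
theorem exists_blockInfo_le {n : ℕ} (T : ℕ) {μH : Measure (Fin (n + 1) → ℂ)}
    [IsProbabilityMeasure μH] (hT : 1 ≤ T) (hent : ⊥ < diffEntropy μH)
    (hmom : ∫⁻ h, ENNReal.ofReal (normSq h) ∂μH < ⊤) :
    ∃ P₀ : ℝ, 1 < P₀ ∧ ∀ P : ℝ, P₀ ≤ P → 0 ≤ Real.logb 2 (Real.logb 2 P) ∧
      ∀ μX : Measure (Fin T → ℂ), IsProbabilityMeasure μX → AveragePower P μX →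
        blockInfo μX μH ≤ ENNReal.ofReal
          (((T : ℝ) - 1) * Real.logb 2 P + (T + 1) * Real.logb 2 (Real.logb 2 P)) := by
  obtain ⟨K, hK⟩ := exists_klDiv_block_le T hT hent hmom
  have hT' : (1 : ℝ) ≤ T := by exact_mod_cast hT
  have hlog2 : 0 < Real.log 2 := Real.log_pos one_lt_two
  have hlog2' : Real.log 2 ≤ 1 := by linarith [Real.log_two_lt_d9]
  -- K' gathers what stays bounded at δ = 1/log P: T is T δ log P, and the last term comes from 1 +
  -- PT ≤ P(1+T). For large P it is absorbed by one extra log log P, whence the coefficient T + 1.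
  set K' := K + T + 2 * T * Real.log (1 + T) with hK'
  have hlim : Tendsto (fun P : ℝ => Real.logb 2 (Real.logb 2 P)) atTop atTop :=
    (Real.tendsto_logb_atTop one_lt_two).comp (Real.tendsto_logb_atTop one_lt_two)
  obtain ⟨P₁, hP₁⟩ := (hlim.eventually_ge_atTop (max (K' / Real.log 2) 0)).exists_forall_of_atTop
  -- P ≥ e gives log P ≥ 1, so that δ = 1/log P ≤ 1.
  refine ⟨max P₁ (Real.exp 1), lt_max_of_lt_right (Real.one_lt_exp_iff.2 one_pos),
    fun P hP => ?_⟩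
  have hPe : Real.exp 1 ≤ P := (le_max_right _ _).trans hP
  have hP1 : 1 ≤ P := (Real.one_le_exp zero_le_one).trans hPe
  have hP0 : 0 < P := by linarith
  have hL : 1 ≤ Real.log P := (Real.le_log_iff_exp_le hP0).2 hPe
  have hLL := hP₁ P ((le_max_left _ _).trans hP)
  refine ⟨(le_max_right _ _).trans hLL, fun μX hX hpow => ?_⟩
  have hδ : 0 < 1 / Real.log P := by positivity
  have hδ1 : 1 / Real.log P ≤ 1 := by rw [div_le_one (by linarith)]; exact hL
  have h1 := hK _ hδ hδ1 P hP0.le μX hX hpow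
  have hlogPT : Real.log (1 + P * T) ≤ Real.log P + Real.log (1 + T) := by
    rw [← Real.log_mul hP0.ne' (by positivity)]
    exact Real.log_le_log (by positivity) (by nlinarith)
  have hlogT : 0 ≤ Real.log (1 + T) := Real.log_nonneg (by linarith)
  have hbound : K + T * Real.log (1 / (1 / Real.log P)) +
      (T * (1 + 1 / Real.log P) - 1) * Real.log (1 + P * T) ≤
      (T - 1) * Real.log P + T * Real.log (Real.log P) + K' := by
    rw [one_div_one_div]
    have e1 : (T * (1 + 1 / Real.log P) - 1) * Real.log (1 + P * T) ≤
        (T * (1 + 1 / Real.log P) - 1) * (Real.log P + Real.log (1 + T)) :=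
      mul_le_mul_of_nonneg_left hlogPT (by nlinarith)
    have e2 : (T * (1 + 1 / Real.log P) - 1) * Real.log P = (T - 1) * Real.log P + T := by
      field_simp
      ring
    have e3 : (T * (1 + 1 / Real.log P) - 1) * Real.log (1 + T) ≤
        2 * T * Real.log (1 + T) :=
      mul_le_mul_of_nonneg_right (by nlinarith) hlogT
    rw [hK']
    nlinarith
  have hLb : Real.log P ≤ Real.logb 2 P := by
    rw [Real.logb, le_div_iff₀ hlog2]
    nlinarith
  have hloglog : Real.log (Real.log P) / Real.log 2 ≤ Real.logb 2 (Real.logb 2 P) :=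
    Real.logb_le_logb_of_le one_lt_two (by linarith) hLb
  rw [blockInfo, mutualInfo]
  refine ENNReal.div_le_of_le_mul (h1.trans ?_)
  rw [← ENNReal.ofReal_mul' hlog2.le]
  refine ENNReal.ofReal_le_ofReal (hbound.trans ?_)
  have f1 : Real.logb 2 P * Real.log 2 = Real.log P := div_mul_cancel₀ _ hlog2.ne'
  have f2 : Real.log (Real.log P) ≤ Real.logb 2 (Real.logb 2 P) * Real.log 2 :=
    (div_le_iff₀ hlog2).1 hloglog
  have f3 : K' ≤ Real.logb 2 (Real.logb 2 P) * Real.log 2 :=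
    (div_le_iff₀ hlog2).1 ((le_max_left _ _).trans hLL)
  have f4 : (T : ℝ) * Real.log (Real.log P) ≤
      T * (Real.logb 2 (Real.logb 2 P) * Real.log 2) := by gcongr
  calc ((T : ℝ) - 1) * Real.log P + T * Real.log (Real.log P) + K'
      ≤ (T - 1) * Real.log P + T * (Real.logb 2 (Real.logb 2 P) * Real.log 2) +
        Real.logb 2 (Real.logb 2 P) * Real.log 2 := by linarith
    _ = _ := by rw [← f1]; ring

/-! ### Degrees of freedom. -/

lemma tendsto_logb_div_self_atTop :
    Tendsto (fun P : ℝ => Real.logb 2 (Real.logb 2 P) / Real.logb 2 P) atTop (nhds 0) := by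
  have h1 : Tendsto (fun u : ℝ => Real.logb 2 u / u) atTop (nhds 0) := by
    have h2 : Tendsto (fun u : ℝ => Real.log u / u) atTop (nhds 0) :=
      Real.isLittleO_log_id_atTop.tendsto_div_nhds_zero
    have h3 := h2.div_const (Real.log 2)
    rw [zero_div] at h3
    refine h3.congr fun u => ?_
    rw [Real.logb, div_right_comm]
  exact h1.comp (Real.tendsto_logb_atTop one_lt_two)

/-- The bound on the information is uniform over inputs, so it passes to the capacity. After
division by T log P the log log term vanishes in the limit. -/
theorem dof_le_of_blockInfo_le {N T : ℕ} {μH : Measure (Fin N → ℂ)} (hT : 1 ≤ T) {c P₀ : ℝ}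
    (hc : 0 ≤ c) (hP₀ : 1 < P₀)
    (h : ∀ P : ℝ, P₀ ≤ P → 0 ≤ Real.logb 2 (Real.logb 2 P) ∧
      ∀ μX : Measure (Fin T → ℂ), IsProbabilityMeasure μX → AveragePower P μX →
        blockInfo μX μH ≤ ENNReal.ofReal
          (((T : ℝ) - 1) * Real.logb 2 P + c * Real.logb 2 (Real.logb 2 P)))
    {d : EReal} (hd : IsAchievableDoF T μH d) : d ≤ ((1 - 1 / (T : ℝ) : ℝ) : EReal) := by
  obtain ⟨R, hR, rfl⟩ := hd
  have hT' : (1 : ℝ) ≤ T := by exact_mod_cast hT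
  have hT0 : (0 : ℝ) < T := by linarith
  have hlim : Tendsto (fun P : ℝ => ((1 - 1 / (T : ℝ) +
      c / T * (Real.logb 2 (Real.logb 2 P) / Real.logb 2 P) : ℝ) : EReal)) atTop
      (nhds ((1 - 1 / (T : ℝ) : ℝ) : EReal)) := by
    refine (continuous_coe_real_ereal.tendsto _).comp ?_
    simpa using (tendsto_logb_div_self_atTop.const_mul (c / T)).const_add (1 - 1 / (T : ℝ))
  rw [← hlim.liminf_eq]
  refine liminf_le_liminf ?_
  filter_upwards [eventually_ge_atTop P₀] with P hP
  obtain ⟨hLL, hI⟩ := h P hP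
  have hP1 : 1 < P := hP₀.trans_le hP
  have hLpos : 0 < Real.logb 2 P := Real.logb_pos one_lt_two hP1
  set r := ((T : ℝ) - 1) * Real.logb 2 P + c * Real.logb 2 (Real.logb 2 P) with hr
  have hr0 : 0 ≤ r :=
    add_nonneg (mul_nonneg (by linarith) hLpos.le) (mul_nonneg hc hLL)
  have hcap : capacity T μH P ≤ ENNReal.ofReal (r / T) := by
    refine iSup_le fun μX => iSup_le fun hX => iSup_le fun hpow => ?_
    rw [ENNReal.ofReal_div_of_pos hT0, ENNReal.ofReal_natCast]
    gcongr
    exact hI μX hX hpow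
  have hRle : (R P : EReal) ≤ ((r / T : ℝ) : EReal) := by
    refine (hR P (by linarith)).trans ((EReal.coe_ennreal_le_coe_ennreal_iff.2 hcap).trans ?_)
    rw [EReal.coe_ennreal_ofReal, max_eq_left (by positivity)]
  rw [EReal.coe_le_coe_iff] at hRle ⊢
  rw [div_le_iff₀ hLpos]
  refine hRle.trans (le_of_eq ?_)
  rw [hr]
  field_simp

end SIMO


theorem mainTheorem2 (N T : ℕ) (hN : 1 ≤ N) (hT : 1 ≤ T)
    (μH : MeasureTheory.Measure (Fin N → ℂ)) [MeasureTheory.IsProbabilityMeasure μH]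
    (hent : ⊥ < SIMO.diffEntropy μH)
    (hmom : ∫⁻ h, ENNReal.ofReal (SIMO.normSq h) ∂μH < ⊤) :
    (∃ c : ℝ, 0 < c ∧ ∃ P₀ : ℝ, ∀ P : ℝ, P₀ ≤ P →
      ∀ μX : MeasureTheory.Measure (Fin T → ℂ), MeasureTheory.IsProbabilityMeasure μX →
        SIMO.AveragePower P μX →
        (SIMO.blockInfo μX μH : EReal) ≤
          ((((T : ℝ) - 1) * max (Real.logb 2 P) 0
            + c * Real.logb 2 (Real.logb 2 P) : ℝ) : EReal)) ∧
    (∀ d : EReal, SIMO.IsAchievableDoF T μH d → d ≤ ((1 - 1 / (T : ℝ) : ℝ) : EReal)) := by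
  -- N ≥ 1 provides the reference row 0 against which the other n rows are compared.
  obtain ⟨n, rfl⟩ : ∃ n, N = n + 1 := ⟨N - 1, by omega⟩
  obtain ⟨P₀, hP₀, h⟩ := SIMO.exists_blockInfo_le T hT hent hmom
  have hT' : (1 : ℝ) ≤ T := by exact_mod_cast hT
  refine ⟨⟨T + 1, by positivity, P₀, fun P hP μX hX hpow => ?_⟩, fun d hd =>
    SIMO.dof_le_of_blockInfo_le hT (by positivity) hP₀ h hd⟩
  obtain ⟨hLL, hI⟩ := h P hP
  have hLpos : 0 < Real.logb 2 P := Real.logb_pos one_lt_two (hP₀.trans_le hP)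
  rw [max_eq_left hLpos.le]
  refine (EReal.coe_ennreal_le_coe_ennreal_iff.2 (hI μX hX hpow)).trans ?_
  rw [EReal.coe_ennreal_ofReal, max_eq_left]
  exact add_nonneg (mul_nonneg (by linarith) hLpos.le) (mul_nonneg (by positivity) hLL)
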